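/- Let $n\ge 0$ and let $(W,J)$ be an almost complex manifold of real dimension $2n+2$: a smooth manifold $W$ with a smooth bundle endomorphism $J$ of $TW$ such that $J^2=-1$. An \emph{almost contact structure} on a smooth $(2n+1)$-manifold $M$ is a smooth hyperplane distribution $\xi\subset TM$ with a smooth complex multiplication $J_\xi:\xi\to\xi$, $J_\xi^2=-1$. Two of them are \emph{homotopic} if they are joined by a smooth family $(\xi_t,J_t)_{t\in[0,1]}$ of almost contact structures on $M$; the homotopy class is called the \emph{formal homotopy class}. A smoothly embedded real hypersurface $M\subset W$ carries the almost contact structure $(\xi_M,J_M)$, where $\xi_M=TM\cap J\,TM$ is the maximal complex subbundle of $TM$ and $J_M$ is the restriction of $J$ to it. An \emph{isotopy} from a submanifold $M_1$ to a submanifold $M_2$ of $W$ is a smooth family of smooth embeddings $F_t:M_1\to W$, $t\in[0,1]$, where $F_0$ is the inclusion and $F_1(M_1)=M_2$. Two submanifolds $M_1,M_2$ of $W$ with almost contact structures $(\xi_1,J_1)$, $(\xi_2,J_2)$ are \emph{almost contact homotopic} if $M_1$ and $M_2$ are isotopic in $W$ and every isotopy $F$ between them carries $(\xi_1,J_1)$,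 by the diffeomorphism $F_1:M_1\to M_2$, to an almost contact structure on $M_2$ that is homotopic to $(\xi_2,J_2)$. Proposition. Any two isotopic real hypersurfaces $M_1,M_2$ in an almost complex manifold $(W,J)$, with the almost contact structures $(\xi_{M_1},J_{M_1})$ and $(\xi_{M_2},J_{M_2})$, are almost contact homotopic. Consequently the formal homotopy class of a hypersurface is an isotopy invariant: for every isotopy $F$ from $M_1$ to $M_2$, the diffeomorphism $F_1$ carries the formal homotopy class of $(\xi_{M_1},J_{M_1})$ onto that of $(\xi_{M_2},J_{M_2})$. -/

import Mathlib

open Set Topology Module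
open scoped Manifold ContDiff

/-! ### Smooth embeddings -/

/-- The differential of a smooth embedding is injective at every point. -/
theorem injective_mfderiv_of_isSmoothEmbedding {a b : ℕ}
    {M : Type*} [TopologicalSpace M] [ChartedSpace (EuclideanSpace ℝ (Fin a)) M]
    [IsManifold (𝓡 a) ∞ M]
    {W : Type*} [TopologicalSpace W] [ChartedSpace (EuclideanSpace ℝ (Fin b)) W]
    [IsManifold (𝓡 b) ∞ W]
    {ι : M → W} (hι : Manifold.IsSmoothEmbedding (𝓡 a) (𝓡 b) ∞ ι) (x : M) :
    Function.Injective (mfderiv (𝓡 a) (𝓡 b) ι x) := by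
  have h := hι.isImmersion.isImmersionAt x
  have hsmooth : MDifferentiableAt (𝓡 a) (𝓡 b) ι x :=
    (hι.contMDiff x).mdifferentiableAt (by simp)
  -- `g` is a smooth map near `ι x` such that `g ∘ ι` is a chart of `M` near `x`
  let g : W → EuclideanSpace ℝ (Fin a) := fun y => (h.equiv.symm (h.codChart.extend (𝓡 b) y)).1
  have hcod : MDifferentiableAt (𝓡 b) 𝓘(ℝ, EuclideanSpace ℝ (Fin b))
      (h.codChart.extend (𝓡 b)) (ι x) :=
    (h.codChart.contMDiffAt_extend h.codChart_mem_maximalAtlas h.mem_codChart_source).mdifferentiableAt (by simp)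
  have hg : MDifferentiableAt (𝓡 b) 𝓘(ℝ, EuclideanSpace ℝ (Fin a)) g (ι x) := by
    have hl : MDifferentiableAt 𝓘(ℝ, EuclideanSpace ℝ (Fin b)) 𝓘(ℝ, EuclideanSpace ℝ (Fin a))
        ((ContinuousLinearMap.fst ℝ (EuclideanSpace ℝ (Fin a)) h.complement).comp
          h.equiv.symm.toContinuousLinearMap) (h.codChart.extend (𝓡 b) (ι x)) :=
      ContinuousLinearMap.mdifferentiableAt _
    exact hl.comp (ι x) hcod
  have hloc : (h.domChart.extend (𝓡 a)) =ᶠ[𝓝 x] g ∘ ι := by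
    filter_upwards [h.domChart.open_source.mem_nhds h.mem_domChart_source] with y hy
    have hy' : y ∈ (h.domChart.extend (𝓡 a)).source := by simpa using hy
    have := h.writtenInCharts ((h.domChart.extend (𝓡 a)).map_source hy')
    simp only [Function.comp_apply, (h.domChart.extend (𝓡 a)).left_inv hy'] at this
    simp only [g, Function.comp_apply] at this ⊢
    rw [this, ContinuousLinearEquiv.symm_apply_apply]
  -- the inverse chart
  have hsymm : MDifferentiableAt 𝓘(ℝ, EuclideanSpace ℝ (Fin a)) (𝓡 a)
      (h.domChart.extend (𝓡 a)).symm (g (ι x)) := by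
    have e : g (ι x) = h.domChart.extend (𝓡 a) x := hloc.eq_of_nhds.symm
    rw [e]
    have := contMDiffOn_extend_symm (I := 𝓡 a) h.domChart_mem_maximalAtlas
    refine (this.contMDiffAt ?_).mdifferentiableAt (by simp)
    have ho : IsOpen ((𝓡 a) '' h.domChart.target) := by simpa using h.domChart.open_target
    exact ho.mem_nhds ⟨_, h.domChart.map_source h.mem_domChart_source, rfl⟩
  have hid : (h.domChart.extend (𝓡 a)).symm ∘ (g ∘ ι) =ᶠ[𝓝 x] id := by
    filter_upwards [hloc, h.domChart.open_source.mem_nhds h.mem_domChart_source] with y hy hy'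
    rw [Function.comp_apply, ← hy]
    exact (h.domChart.extend (𝓡 a)).left_inv (by simpa using hy')
  have hcomp := hid.mfderiv_eq (I := 𝓡 a) (I' := 𝓡 a)
  rw [mfderiv_comp x hsymm (hg.comp x hsmooth), mfderiv_comp x hg hsmooth, mfderiv_id] at hcomp
  intro v w hvw
  have h1 := congrArg (fun L => L v) hcomp
  have h2 := congrArg (fun L => L w) hcomp
  simp only [ContinuousLinearMap.comp_apply] at h1 h2
  rw [hvw] at h1
  exact h1.symm.trans h2


/-- Two smooth embeddings with the same image differ by a unique diffeomorphism: this is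
`ι₂⁻¹ ∘ ι₁ : M₁ → M₂`. -/
noncomputable def diffeoOfRangeEq {a b : ℕ}
    {M₁ : Type*} [TopologicalSpace M₁] [ChartedSpace (EuclideanSpace ℝ (Fin a)) M₁]
    {M₂ : Type*} [TopologicalSpace M₂] [ChartedSpace (EuclideanSpace ℝ (Fin a)) M₂]
    {W : Type*} [TopologicalSpace W] [ChartedSpace (EuclideanSpace ℝ (Fin b)) W]
    [IsManifold (𝓡 a) ∞ M₁] [IsManifold (𝓡 a) ∞ M₂] [IsManifold (𝓡 b) ∞ W]
    {ι₁ : M₁ → W} {ι₂ : M₂ → W} (h₁ : Manifold.IsSmoothEmbedding (𝓡 a) (𝓡 b) ∞ ι₁)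
    (h₂ : Manifold.IsSmoothEmbedding (𝓡 a) (𝓡 b) ∞ ι₂) (h : range ι₁ = range ι₂) :
    M₁ ≃ₘ^∞⟮𝓡 a, 𝓡 a⟯ M₂ :=
  let e : M₁ ≃ₜ M₂ := (h₁.isEmbedding.toHomeomorph.trans (Homeomorph.setCongr h)).trans
    h₂.isEmbedding.toHomeomorph.symm
  have he : ∀ x, ι₂ (e x) = ι₁ x := fun x =>
    congrArg Subtype.val (h₂.isEmbedding.toHomeomorph.apply_symm_apply
      (Homeomorph.setCongr h (h₁.isEmbedding.toHomeomorph x)))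
  have he' : ∀ y, ι₁ (e.symm y) = ι₂ y := fun y => by rw [← he, e.apply_symm_apply]
  { toEquiv := e.toEquiv
    contMDiff_toFun := by
      refine (ContMDiff.iff_comp_isImmersion h₂.isImmersion).2 ⟨e.continuous, ?_⟩
      exact h₁.contMDiff.congr he
    contMDiff_invFun := by
      refine (ContMDiff.iff_comp_isImmersion h₁.isImmersion).2 ⟨e.symm.continuous, ?_⟩
      exact h₂.contMDiff.congr he' }

theorem diffeoOfRangeEq_apply {a b : ℕ}
    {M₁ : Type*} [TopologicalSpace M₁] [ChartedSpace (EuclideanSpace ℝ (Fin a)) M₁]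
    {M₂ : Type*} [TopologicalSpace M₂] [ChartedSpace (EuclideanSpace ℝ (Fin a)) M₂]
    {W : Type*} [TopologicalSpace W] [ChartedSpace (EuclideanSpace ℝ (Fin b)) W]
    [IsManifold (𝓡 a) ∞ M₁] [IsManifold (𝓡 a) ∞ M₂] [IsManifold (𝓡 b) ∞ W]
    {ι₁ : M₁ → W} {ι₂ : M₂ → W} (h₁ : Manifold.IsSmoothEmbedding (𝓡 a) (𝓡 b) ∞ ι₁)
    (h₂ : Manifold.IsSmoothEmbedding (𝓡 a) (𝓡 b) ∞ ι₂) (h : range ι₁ = range ι₂) (x : M₁) :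
    ι₂ (diffeoOfRangeEq h₁ h₂ h x) = ι₁ x :=
  congrArg Subtype.val (h₂.isEmbedding.toHomeomorph.apply_symm_apply
    (Homeomorph.setCongr h (h₁.isEmbedding.toHomeomorph x)))

/-! ### Almost contact structures -/

/-- A (not necessarily continuous) field on a `(2n+1)`-manifold `M` of hyperplanes
`ξ x ⊂ T_x M`, each with a complex multiplication `J x : ξ x → ξ x`.
An almost contact structure on `M` is such a field that is moreover smooth, see
`AlmostContactField.IsSmooth`. -/
@[ext]
structure AlmostContactField (n : ℕ) (M : Type*) [TopologicalSpace M]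
    [ChartedSpace (EuclideanSpace ℝ (Fin (2 * n + 1))) M] where
  ξ : ∀ x : M, Submodule ℝ (TangentSpace (𝓡 (2 * n + 1)) x)
  J : ∀ x : M, ξ x →ₗ[ℝ] ξ x
  finrank_ξ : ∀ x, finrank ℝ (ξ x) = 2 * n
  J_J : ∀ x v, J x (J x v) = -v

namespace AlmostContactField

/-- `S` is a (smooth) almost contact structure: near every point, `ξ` has a smooth frame
`X 1, …, X 2n` such that the `J (X i)` are smooth as well. -/
def IsSmooth {n : ℕ} {M : Type*} [TopologicalSpace M]
    [ChartedSpace (EuclideanSpace ℝ (Fin (2 * n + 1))) M] [IsManifold (𝓡 (2 * n + 1)) ∞ M]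
    (S : AlmostContactField n M) : Prop :=
  ∀ x₀ : M, ∃ U : Set M, IsOpen U ∧ x₀ ∈ U ∧ ∃ X : Fin (2 * n) → ∀ x : M, S.ξ x,
    (∀ i, ContMDiffOn (𝓡 (2 * n + 1)) (𝓡 (2 * n + 1)).tangent ∞
      (fun x => (⟨x, (X i x : TangentSpace (𝓡 (2 * n + 1)) x)⟩ :
        TangentBundle (𝓡 (2 * n + 1)) M)) U) ∧
    (∀ i, ContMDiffOn (𝓡 (2 * n + 1)) (𝓡 (2 * n + 1)).tangent ∞
      (fun x => (⟨x, (S.J x (X i x) : TangentSpace (𝓡 (2 * n + 1)) x)⟩ :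
        TangentBundle (𝓡 (2 * n + 1)) M)) U) ∧
    ∀ x ∈ U, Submodule.span ℝ (range fun i => X i x) = ⊤

/-- The family `A t = (ξ_t, J_t)`, `t ∈ [0,1]`, depends smoothly on `(t, x) ∈ [0,1] × M`:
near every point of `[0,1] × M` there are smooth families of vector fields `X 1, …, X 2n`, which
frame `ξ_t` and for which the `J_t (X i)` are smooth as well. -/
def IsSmoothFamily {n : ℕ} {M : Type*} [TopologicalSpace M]
    [ChartedSpace (EuclideanSpace ℝ (Fin (2 * n + 1))) M] [IsManifold (𝓡 (2 * n + 1)) ∞ M]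
    (A : ℝ → AlmostContactField n M) : Prop :=
  ∀ p₀ ∈ Icc (0 : ℝ) 1 ×ˢ (univ : Set M), ∃ U : Set (ℝ × M), IsOpen U ∧ p₀ ∈ U ∧
    ∃ X : Fin (2 * n) → ∀ p : ℝ × M, (A p.1).ξ p.2,
    (∀ i, ContMDiffOn (𝓘(ℝ, ℝ).prod (𝓡 (2 * n + 1))) (𝓡 (2 * n + 1)).tangent ∞
      (fun p => (⟨p.2, (X i p : TangentSpace (𝓡 (2 * n + 1)) p.2)⟩ :
        TangentBundle (𝓡 (2 * n + 1)) M)) (U ∩ Icc (0 : ℝ) 1 ×ˢ univ)) ∧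
    (∀ i, ContMDiffOn (𝓘(ℝ, ℝ).prod (𝓡 (2 * n + 1))) (𝓡 (2 * n + 1)).tangent ∞
      (fun p => (⟨p.2, ((A p.1).J p.2 (X i p) : TangentSpace (𝓡 (2 * n + 1)) p.2)⟩ :
        TangentBundle (𝓡 (2 * n + 1)) M)) (U ∩ Icc (0 : ℝ) 1 ×ˢ univ)) ∧
    ∀ p ∈ U ∩ Icc (0 : ℝ) 1 ×ˢ univ, Submodule.span ℝ (range fun i => X i p) = ⊤

/-- Two almost contact structures on `M` are homotopic if they are the ends of a smooth family
of almost contact structures on `M`. -/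
def Homotopic {n : ℕ} {M : Type*} [TopologicalSpace M]
    [ChartedSpace (EuclideanSpace ℝ (Fin (2 * n + 1))) M] [IsManifold (𝓡 (2 * n + 1)) ∞ M]
    (S T : AlmostContactField n M) : Prop :=
  ∃ A : ℝ → AlmostContactField n M, IsSmoothFamily A ∧ A 0 = S ∧ A 1 = T

/-- The homotopy class of `S` in the space of almost contact structures on `M`. -/
def formalHomotopyClass {n : ℕ} {M : Type*} [TopologicalSpace M]
    [ChartedSpace (EuclideanSpace ℝ (Fin (2 * n + 1))) M] [IsManifold (𝓡 (2 * n + 1)) ∞ M]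
    (S : AlmostContactField n M) : Set (AlmostContactField n M) :=
  {T | T.IsSmooth ∧ Homotopic S T}

/-- The structure `φ_* (ξ, J)` on `M₂` to which a diffeomorphism `φ : M₁ → M₂` carries the
structure `(ξ, J)` on `M₁`. It is written with the differential of `φ⁻¹`:
`φ_* ξ = (dφ⁻¹)⁻¹ ξ` and `φ_* J = (dφ⁻¹)⁻¹ ∘ J ∘ dφ⁻¹`. -/
noncomputable def map {n : ℕ}
    {M₁ : Type*} [TopologicalSpace M₁] [ChartedSpace (EuclideanSpace ℝ (Fin (2 * n + 1))) M₁]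
    {M₂ : Type*} [TopologicalSpace M₂] [ChartedSpace (EuclideanSpace ℝ (Fin (2 * n + 1))) M₂]
    [IsManifold (𝓡 (2 * n + 1)) ∞ M₁] [IsManifold (𝓡 (2 * n + 1)) ∞ M₂]
    (φ : M₁ ≃ₘ^∞⟮𝓡 (2 * n + 1), 𝓡 (2 * n + 1)⟯ M₂) (S : AlmostContactField n M₁) :
    AlmostContactField n M₂ :=
  let d := fun y : M₂ => (φ.symm.mfderivToContinuousLinearEquiv (by simp) y).toLinearEquiv
  { ξ := fun y => (S.ξ (φ.symm y)).comap (d y).toLinearMap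
    J := fun y => ((d y).ofSubmodule' (S.ξ (φ.symm y))).symm.conj (S.J (φ.symm y))
    finrank_ξ := fun y => by
      exact ((d y).ofSubmodule' (S.ξ (φ.symm y))).finrank_eq.trans (S.finrank_ξ (φ.symm y))
    J_J := fun y v => by
      simp [LinearEquiv.conj_apply, S.J_J] }

end AlmostContactField

/-! ### Almost complex manifolds and their hypersurfaces -/

/-- A smooth almost complex structure on `W`: a smooth bundle endomorphism `J` of `TW` with
`J² = -1`. -/
structure AlmostComplexStructure (b : ℕ) (W : Type*) [TopologicalSpace W]
    [ChartedSpace (EuclideanSpace ℝ (Fin b)) W] [IsManifold (𝓡 b) ∞ W] where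
  toFun : ∀ x : W, TangentSpace (𝓡 b) x →ₗ[ℝ] TangentSpace (𝓡 b) x
  sq : ∀ x v, toFun x (toFun x v) = -v
  smooth : ContMDiff (𝓡 b).tangent (𝓡 b).tangent ∞
    (fun v : TangentBundle (𝓡 b) W => (⟨v.1, toFun v.1 v.2⟩ : TangentBundle (𝓡 b) W))

/-- If `J² = -1` on a real vector space of dimension `2n+2` and `H` is a real hyperplane, then
`H ∩ J H` has real dimension `2n`. -/
theorem finrank_inf_map_complex {V : Type*} [AddCommGroup V] [Module ℝ V] [FiniteDimensional ℝ V]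
    {n : ℕ} (hV : finrank ℝ V = 2 * n + 2) (J : V →ₗ[ℝ] V) (hJ : ∀ v, J (J v) = -v)
    (H : Submodule ℝ V) (hH : finrank ℝ H = 2 * n + 1) :
    finrank ℝ (H ⊓ H.map J : Submodule ℝ V) = 2 * n := by
  have hinj : Function.Injective J := fun v w h => by
    have := congrArg J h
    rwa [hJ, hJ, neg_inj] at this
  have h1 : finrank ℝ (H.map J) = 2 * n + 1 := by
    rw [← hH]
    exact (Submodule.equivMapOfInjective J hinj H).finrank_eq.symm
  have h2 := Submodule.finrank_sup_add_finrank_inf_eq H (H.map J)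
  have h3 : finrank ℝ (H ⊔ H.map J : Submodule ℝ V) ≤ 2 * n + 2 := hV ▸ Submodule.finrank_le _
  have h4 : finrank ℝ (H ⊓ H.map J : Submodule ℝ V) ≠ 2 * n + 1 := by
    intro h
    have hE : H ⊓ H.map J = H := Submodule.eq_of_le_of_finrank_eq inf_le_left (by rw [h, hH])
    have hst : ∀ v ∈ H, J v ∈ H := by
      intro v hv
      rw [← hE] at hv
      obtain ⟨w, hw, rfl⟩ := hv.2
      rw [hJ]
      exact H.neg_mem hw
    have hsq : (J.restrict hst) ∘ₗ (J.restrict hst) = (-1 : ℝ) • LinearMap.id := by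
      ext v
      simp [hJ]
    have hdet := congrArg LinearMap.det hsq
    rw [LinearMap.det_comp, LinearMap.det_smul, hH, LinearMap.det_id,
      Odd.neg_one_pow ⟨n, rfl⟩] at hdet
    nlinarith [mul_self_nonneg (LinearMap.det (J.restrict hst))]
  have h5 : finrank ℝ (H ⊓ H.map J : Submodule ℝ V) ≤ 2 * n + 1 :=
    hH ▸ Submodule.finrank_mono inf_le_left
  omega

namespace AlmostComplexStructure

/-- The maximal complex subspace `T_x M ∩ J T_x M` of the tangent space at `x` of the hypersurface
`ι : M → W`, as a subspace of the tangent space `T_{ι x} W`. -/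
noncomputable def maximalComplex {a b : ℕ}
    {M : Type*} [TopologicalSpace M] [ChartedSpace (EuclideanSpace ℝ (Fin a)) M]
    {W : Type*} [TopologicalSpace W] [ChartedSpace (EuclideanSpace ℝ (Fin b)) W]
    [IsManifold (𝓡 b) ∞ W] (J : AlmostComplexStructure b W) (ι : M → W) (x : M) :
    Submodule ℝ (TangentSpace (𝓡 b) (ι x)) :=
  let T : Submodule ℝ (TangentSpace (𝓡 b) (ι x)) :=
    LinearMap.range (mfderiv (𝓡 a) (𝓡 b) ι x).toLinearMap
  T ⊓ T.map (J.toFun (ι x))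

theorem mem_maximalComplex {a b : ℕ}
    {M : Type*} [TopologicalSpace M] [ChartedSpace (EuclideanSpace ℝ (Fin a)) M]
    {W : Type*} [TopologicalSpace W] [ChartedSpace (EuclideanSpace ℝ (Fin b)) W]
    [IsManifold (𝓡 b) ∞ W] (J : AlmostComplexStructure b W) (ι : M → W) (x : M)
    (v : TangentSpace (𝓡 b) (ι x)) (hv : v ∈ J.maximalComplex (a := a) ι x) :
    J.toFun (ι x) v ∈ J.maximalComplex (a := a) ι x := by
  obtain ⟨h1, w, hw, rfl⟩ := hv
  refine ⟨?_, Submodule.mem_map_of_mem h1⟩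
  rw [J.sq]
  exact Submodule.neg_mem _ hw

/-- The differential of a hypersurface `ι : M → W` as an isomorphism of the subspace of `T_x M`
that corresponds to `T_x M ∩ J T_x M` onto `T_x M ∩ J T_x M`. -/
noncomputable def maximalComplexEquiv {a b : ℕ}
    {M : Type*} [TopologicalSpace M] [ChartedSpace (EuclideanSpace ℝ (Fin a)) M]
    [IsManifold (𝓡 a) ∞ M]
    {W : Type*} [TopologicalSpace W] [ChartedSpace (EuclideanSpace ℝ (Fin b)) W]
    [IsManifold (𝓡 b) ∞ W] (J : AlmostComplexStructure b W) {ι : M → W}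
    (hι : Manifold.IsSmoothEmbedding (𝓡 a) (𝓡 b) ∞ ι) (x : M) :
    (J.maximalComplex (a := a) ι x).comap (mfderiv (𝓡 a) (𝓡 b) ι x).toLinearMap ≃ₗ[ℝ]
      J.maximalComplex (a := a) ι x :=
  LinearEquiv.ofBijective
    ((mfderiv (𝓡 a) (𝓡 b) ι x).toLinearMap.restrict fun _ hv => hv) (by
      refine ⟨fun v w h => ?_, fun w => ?_⟩
      · exact Subtype.ext (injective_mfderiv_of_isSmoothEmbedding hι x (congrArg Subtype.val h))
      · obtain ⟨v, hv⟩ := w.2.1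
        exact ⟨⟨v, by simp only [Submodule.mem_comap]; rw [hv]; exact w.2⟩, Subtype.ext hv⟩)

/-- The almost contact structure of a real hypersurface `ι : M → W` in an almost complex manifold
`(W, J)`: the maximal complex subbundle `TM ∩ J TM` with the complex structure induced by `J`,
carried to `M` by the differential of `ι`. -/
noncomputable def almostContact {n : ℕ}
    {M : Type*} [TopologicalSpace M] [ChartedSpace (EuclideanSpace ℝ (Fin (2 * n + 1))) M]
    [IsManifold (𝓡 (2 * n + 1)) ∞ M]
    {W : Type*} [TopologicalSpace W] [ChartedSpace (EuclideanSpace ℝ (Fin (2 * n + 2))) W]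
    [IsManifold (𝓡 (2 * n + 2)) ∞ W] (J : AlmostComplexStructure (2 * n + 2) W) {ι : M → W}
    (hι : Manifold.IsSmoothEmbedding (𝓡 (2 * n + 1)) (𝓡 (2 * n + 2)) ∞ ι) :
    AlmostContactField n M where
  ξ x := (J.maximalComplex (a := 2 * n + 1) ι x).comap
    (mfderiv (𝓡 (2 * n + 1)) (𝓡 (2 * n + 2)) ι x).toLinearMap
  J x := (J.maximalComplexEquiv hι x).symm.conj
    ((J.toFun (ι x)).restrict (J.mem_maximalComplex ι x))
  finrank_ξ x := by
    rw [(J.maximalComplexEquiv hι x).finrank_eq]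
    have hfin : FiniteDimensional ℝ (TangentSpace (𝓡 (2 * n + 2)) (ι x)) :=
      inferInstanceAs (FiniteDimensional ℝ (EuclideanSpace ℝ (Fin (2 * n + 2))))
    have hW : finrank ℝ (TangentSpace (𝓡 (2 * n + 2)) (ι x)) = 2 * n + 2 :=
      finrank_euclideanSpace_fin
    have hM : finrank ℝ (TangentSpace (𝓡 (2 * n + 1)) x) = 2 * n + 1 :=
      finrank_euclideanSpace_fin
    exact finrank_inf_map_complex hW (J.toFun (ι x)) (J.sq (ι x)) _
      ((LinearMap.finrank_range_of_inj (injective_mfderiv_of_isSmoothEmbedding hι x)).trans hM)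
  J_J x v := by
    apply (J.maximalComplexEquiv hι x).injective
    apply Subtype.ext
    simp [LinearEquiv.conj_apply, J.sq]

/-- The complex structure of a hypersurface is the restriction of `J`: the differential of `ι`
intertwines the two. -/
theorem mfderiv_almostContact_J {n : ℕ}
    {M : Type*} [TopologicalSpace M] [ChartedSpace (EuclideanSpace ℝ (Fin (2 * n + 1))) M]
    [IsManifold (𝓡 (2 * n + 1)) ∞ M]
    {W : Type*} [TopologicalSpace W] [ChartedSpace (EuclideanSpace ℝ (Fin (2 * n + 2))) W]
    [IsManifold (𝓡 (2 * n + 2)) ∞ W] (J : AlmostComplexStructure (2 * n + 2) W) {ι : M → W}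
    (hι : Manifold.IsSmoothEmbedding (𝓡 (2 * n + 1)) (𝓡 (2 * n + 2)) ∞ ι) (x : M)
    (v : (J.almostContact hι).ξ x) :
    mfderiv (𝓡 (2 * n + 1)) (𝓡 (2 * n + 2)) ι x ((J.almostContact hι).J x v) =
      J.toFun (ι x) (mfderiv (𝓡 (2 * n + 1)) (𝓡 (2 * n + 2)) ι x v) :=
  congrArg Subtype.val ((J.maximalComplexEquiv hι x).apply_symm_apply
    ((J.toFun (ι x)).restrict (J.mem_maximalComplex ι x) (J.maximalComplexEquiv hι x v)))

end AlmostComplexStructure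

/-! ### Isotopies -/

/-- `F` is a smooth isotopy in `W` from the submanifold `ι₁ : M₁ → W` to the submanifold
`ι₂ : M₂ → W`: a smooth family of smooth embeddings `F t : M₁ → W`, `t ∈ [0,1]`, that starts at
the inclusion `ι₁` of the first and ends with image the second. -/
structure IsIsotopy {a b : ℕ}
    {M₁ : Type*} [TopologicalSpace M₁] [ChartedSpace (EuclideanSpace ℝ (Fin a)) M₁]
    {M₂ : Type*}
    {W : Type*} [TopologicalSpace W] [ChartedSpace (EuclideanSpace ℝ (Fin b)) W]
    (ι₁ : M₁ → W) (ι₂ : M₂ → W) (F : ℝ → M₁ → W) : Prop where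
  smooth : ContMDiffOn (𝓘(ℝ, ℝ).prod (𝓡 a)) (𝓡 b) ∞ (fun p : ℝ × M₁ => F p.1 p.2)
    (Icc (0 : ℝ) 1 ×ˢ univ)
  isSmoothEmbedding : ∀ t ∈ Icc (0 : ℝ) 1, Manifold.IsSmoothEmbedding (𝓡 a) (𝓡 b) ∞ (F t)
  start : F 0 = ι₁
  range_finish : range (F 1) = range ι₂

/-- Two submanifolds of `W` are isotopic if there is an isotopy between them. -/
def Isotopic (a b : ℕ)
    {M₁ : Type*} [TopologicalSpace M₁] [ChartedSpace (EuclideanSpace ℝ (Fin a)) M₁]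
    {M₂ : Type*}
    {W : Type*} [TopologicalSpace W] [ChartedSpace (EuclideanSpace ℝ (Fin b)) W]
    (ι₁ : M₁ → W) (ι₂ : M₂ → W) : Prop :=
  ∃ F : ℝ → M₁ → W, IsIsotopy (a := a) (b := b) ι₁ ι₂ F

/-- The diffeomorphism `ι₂⁻¹ ∘ F 1 : M₁ → M₂` given by an isotopy. -/
noncomputable def IsIsotopy.diffeo {a b : ℕ}
    {M₁ : Type*} [TopologicalSpace M₁] [ChartedSpace (EuclideanSpace ℝ (Fin a)) M₁]
    {M₂ : Type*} [TopologicalSpace M₂] [ChartedSpace (EuclideanSpace ℝ (Fin a)) M₂]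
    {W : Type*} [TopologicalSpace W] [ChartedSpace (EuclideanSpace ℝ (Fin b)) W]
    [IsManifold (𝓡 a) ∞ M₁] [IsManifold (𝓡 a) ∞ M₂] [IsManifold (𝓡 b) ∞ W]
    {ι₁ : M₁ → W} {ι₂ : M₂ → W} {F : ℝ → M₁ → W} (hF : IsIsotopy (a := a) (b := b) ι₁ ι₂ F)
    (h₂ : Manifold.IsSmoothEmbedding (𝓡 a) (𝓡 b) ∞ ι₂) : M₁ ≃ₘ^∞⟮𝓡 a, 𝓡 a⟯ M₂ :=
  diffeoOfRangeEq (hF.isSmoothEmbedding 1 (by simp)) h₂ hF.range_finish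

/-- The almost contact manifolds `(M₁, S₁)` and `(M₂, S₂)`, embedded in `W` by `ι₁` and `ι₂`, are
almost contact homotopic: `S₁` and `S₂` are almost contact structures, `M₁` and `M₂` are isotopic
submanifolds of `W`, and every isotopy between them carries `S₁` to an almost contact structure on
`M₂` that is homotopic to `S₂`. -/
def AlmostContactHomotopic {n b : ℕ}
    {M₁ : Type*} [TopologicalSpace M₁] [ChartedSpace (EuclideanSpace ℝ (Fin (2 * n + 1))) M₁]
    {M₂ : Type*} [TopologicalSpace M₂] [ChartedSpace (EuclideanSpace ℝ (Fin (2 * n + 1))) M₂]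
    {W : Type*} [TopologicalSpace W] [ChartedSpace (EuclideanSpace ℝ (Fin b)) W]
    [IsManifold (𝓡 (2 * n + 1)) ∞ M₁] [IsManifold (𝓡 (2 * n + 1)) ∞ M₂] [IsManifold (𝓡 b) ∞ W]
    (ι₁ : M₁ → W) {ι₂ : M₂ → W}
    (h₂ : Manifold.IsSmoothEmbedding (𝓡 (2 * n + 1)) (𝓡 b) ∞ ι₂)
    (S₁ : AlmostContactField n M₁) (S₂ : AlmostContactField n M₂) : Prop :=
  S₁.IsSmooth ∧ S₂.IsSmooth ∧ Isotopic (2 * n + 1) b ι₁ ι₂ ∧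
    ∀ (F : ℝ → M₁ → W) (hF : IsIsotopy (a := 2 * n + 1) (b := b) ι₁ ι₂ F),
      (S₁.map (hF.diffeo h₂)).Homotopic S₂

/-!
An isotopy `F` from `M₁` to `M₂` passes through embedded hypersurfaces `F t : M₁ → W`, and each of
them induces an almost contact structure `A t` on the same manifold `M₁`. The family `A` is smooth
and joins the structure of `M₁` to the one induced by `F 1`, which the diffeomorphism
`ι₂⁻¹ ∘ F 1` carries to the structure of `M₂` (`map_almostContact`). Pushing `A` forward by this
diffeomorphism is therefore a homotopy as required.

The main point is the smoothness of `A` (`isSmoothFamily_almostContact`). Adding a fixed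
transverse vector to `dF t` in local coordinates gives a family of invertible matrices, whose
inverses depend smoothly on the point; they yield a smooth normal form `ν` and a smooth tangential
projection `π` (`exists_normal_form_and_projection`). Since `J² = -1`, the hyperplane
`TM ∩ J TM` consists of the `v` with `J v` tangent to `M`, so it is the kernel of `θ = ν ∘ J ∘ dF`,
and its complex multiplication is `κ = π ∘ J ∘ dF`. A frame of the kernel of `θ` at one point is
moved to nearby points by projecting along a transverse vector, and the resulting frame is smooth
(`isSmoothFamily_of_ker`).

The equality of homotopy classes follows because homotopy is symmetric and transitive, where for
transitivity the two families are first reparametrized to be constant near the gluing time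
(`Homotopic.trans`), and because diffeomorphisms preserve homotopies (`Homotopic.map`).
-/

/-! ### Tangent maps of diffeomorphisms -/

theorem Diffeomorph.tangentMap_tangentMap_symm {a : ℕ}
    {M : Type*} [TopologicalSpace M] [ChartedSpace (EuclideanSpace ℝ (Fin a)) M]
    {M' : Type*} [TopologicalSpace M'] [ChartedSpace (EuclideanSpace ℝ (Fin a)) M']
    (φ : M ≃ₘ^∞⟮𝓡 a, 𝓡 a⟯ M') (q : TangentBundle (𝓡 a) M') :
    tangentMap (𝓡 a) (𝓡 a) φ (tangentMap (𝓡 a) (𝓡 a) φ.symm q) = q := by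
  rw [← tangentMap_comp_at q (φ.mdifferentiable (by simp) _) (φ.symm.mdifferentiable (by simp) _)]
  have hid : (φ : M → M') ∘ φ.symm = id := funext φ.apply_symm_apply
  rw [hid, tangentMap_id, id]

/-! ### Smooth families and homotopies of almost contact structures -/

namespace AlmostContactField

section

variable {n : ℕ}
  {M : Type*} [TopologicalSpace M] [ChartedSpace (EuclideanSpace ℝ (Fin (2 * n + 1))) M]
  {M' : Type*} [TopologicalSpace M'] [ChartedSpace (EuclideanSpace ℝ (Fin (2 * n + 1))) M']

theorem ext_of_forall_mem {S T : AlmostContactField n M} (hξ : ∀ x v, v ∈ S.ξ x ↔ v ∈ T.ξ x)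
    (hJ : ∀ x v (hS : v ∈ S.ξ x) (hT : v ∈ T.ξ x),
      (S.J x ⟨v, hS⟩ : TangentSpace (𝓡 (2 * n + 1)) x) = T.J x ⟨v, hT⟩) : S = T := by
  obtain ⟨ξ, J, h1, h2⟩ := S
  obtain ⟨ξ', J', h1', h2'⟩ := T
  obtain rfl : ξ = ξ' := funext fun x => Submodule.ext fun v => hξ x v
  obtain rfl : J = J' := funext fun x => LinearMap.ext fun v => Subtype.ext (hJ x v v.2 v.2)
  rfl

variable [IsManifold (𝓡 (2 * n + 1)) ∞ M] [IsManifold (𝓡 (2 * n + 1)) ∞ M']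

theorem IsSmoothFamily.isSmooth {A : ℝ → AlmostContactField n M} (hA : IsSmoothFamily A) {t : ℝ}
    (ht : t ∈ Icc (0 : ℝ) 1) : (A t).IsSmooth := by
  intro x₀
  obtain ⟨U, hU, hx₀, X, hX, hJX, hspan⟩ := hA (t, x₀) ⟨ht, mem_univ _⟩
  have hslice : ContMDiff (𝓡 (2 * n + 1)) (𝓘(ℝ, ℝ).prod (𝓡 (2 * n + 1))) ∞
      (fun x : M => (t, x)) := contMDiff_const.prodMk contMDiff_id
  have hmaps : MapsTo (fun x : M => (t, x)) ((fun x : M => (t, x)) ⁻¹' U)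
      (U ∩ Icc (0 : ℝ) 1 ×ˢ univ) := fun x hx => ⟨hx, ht, mem_univ _⟩
  exact ⟨_, hU.preimage hslice.continuous, hx₀, fun i x => X i (t, x),
    fun i => (hX i).comp hslice.contMDiffOn hmaps,
    fun i => (hJX i).comp hslice.contMDiffOn hmaps, fun x hx => hspan _ (hmaps hx)⟩

theorem IsSmooth.isSmoothFamily_const {S : AlmostContactField n M} (hS : S.IsSmooth) :
    IsSmoothFamily fun _ => S := by
  rintro ⟨t₀, x₀⟩ -
  obtain ⟨U, hU, hx₀, X, hX, hJX, hspan⟩ := hS x₀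
  have hmaps : MapsTo (Prod.snd : ℝ × M → M) (Prod.snd ⁻¹' U ∩ Icc (0 : ℝ) 1 ×ˢ univ) U :=
    fun p hp => hp.1
  exact ⟨_, hU.preimage continuous_snd, hx₀, fun i p => X i p.2,
    fun i => (hX i).comp contMDiffOn_snd hmaps,
    fun i => (hJX i).comp contMDiffOn_snd hmaps, fun p hp => hspan _ (hmaps hp)⟩

theorem IsSmoothFamily.comp {A : ℝ → AlmostContactField n M} (hA : IsSmoothFamily A) {σ : ℝ → ℝ}
    (hσ : ContDiff ℝ ∞ σ) (hmem : MapsTo σ (Icc 0 1) (Icc 0 1)) :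
    IsSmoothFamily fun t => A (σ t) := by
  rintro ⟨t₀, x₀⟩ ⟨ht₀, -⟩
  obtain ⟨U, hU, hx₀, X, hX, hJX, hspan⟩ := hA (σ t₀, x₀) ⟨hmem ht₀, mem_univ _⟩
  have hrep : ContMDiff (𝓘(ℝ, ℝ).prod (𝓡 (2 * n + 1))) (𝓘(ℝ, ℝ).prod (𝓡 (2 * n + 1))) ∞
      (fun p : ℝ × M => (σ p.1, p.2)) :=
    (hσ.contMDiff.comp contMDiff_fst).prodMk contMDiff_snd
  have hmaps : MapsTo (fun p : ℝ × M => (σ p.1, p.2))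
      ((fun p : ℝ × M => (σ p.1, p.2)) ⁻¹' U ∩ Icc (0 : ℝ) 1 ×ˢ univ)
      (U ∩ Icc (0 : ℝ) 1 ×ˢ univ) := fun p hp => ⟨hp.1, hmem hp.2.1, mem_univ _⟩
  exact ⟨_, hU.preimage hrep.continuous, hx₀, fun i p => X i (σ p.1, p.2),
    fun i => (hX i).comp hrep.contMDiffOn hmaps,
    fun i => (hJX i).comp hrep.contMDiffOn hmaps, fun p hp => hspan _ (hmaps hp)⟩

/-- Smoothness of a family is local in the parameter. -/
theorem isSmoothFamily_of_eventuallyEq {A : ℝ → AlmostContactField n M}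
    (h : ∀ t ∈ Icc (0 : ℝ) 1, ∃ B, IsSmoothFamily B ∧ A =ᶠ[𝓝 t] B) : IsSmoothFamily A := by
  classical
  rintro ⟨t₀, x₀⟩ ⟨ht₀, -⟩
  obtain ⟨B, hB, hAB⟩ := h t₀ ht₀
  obtain ⟨V, hV, hVo, ht₀V⟩ := eventually_nhds_iff.1 hAB
  obtain ⟨U, hU, hx₀, X, hX, hJX, hspan⟩ := hB (t₀, x₀) ⟨ht₀, mem_univ _⟩
  -- the frame of `B`, regarded as a frame of `A` where the two families agree
  let Y : Fin (2 * n) → ∀ p : ℝ × M, (A p.1).ξ p.2 := fun i p =>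
    if hp : A p.1 = B p.1 then ⟨X i p, by rw [hp]; exact (X i p).2⟩ else 0
  have transport : ∀ S T : AlmostContactField n M, S = T → ∀ (x : M) (Z : Fin (2 * n) → T.ξ x)
      (Y : Fin (2 * n) → S.ξ x), (∀ i, (Y i : TangentSpace (𝓡 (2 * n + 1)) x) = Z i) →
      (∀ i, (S.J x (Y i) : TangentSpace (𝓡 (2 * n + 1)) x) = T.J x (Z i)) ∧
      (Submodule.span ℝ (range Z) = ⊤ → Submodule.span ℝ (range Y) = ⊤) := by
    rintro S _ rfl x Z Y hYZ
    obtain rfl : Y = Z := funext fun i => Subtype.ext (hYZ i)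
    exact ⟨fun _ => rfl, id⟩
  have hY : ∀ p ∈ (U ∩ Prod.fst ⁻¹' V) ∩ Icc (0 : ℝ) 1 ×ˢ (univ : Set M), ∀ i,
      (Y i p : TangentSpace (𝓡 (2 * n + 1)) p.2) = X i p := by
    intro p hp i
    simp only [Y, dif_pos (hV p.1 hp.1.2)]
  have hsub : (U ∩ Prod.fst ⁻¹' V) ∩ Icc (0 : ℝ) 1 ×ˢ (univ : Set M) ⊆
      U ∩ Icc (0 : ℝ) 1 ×ˢ univ := inter_subset_inter_left _ inter_subset_left
  refine ⟨_, hU.inter (hVo.preimage continuous_fst), ⟨hx₀, ht₀V⟩, Y, fun i => ?_, fun i => ?_,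
    fun p hp => ?_⟩
  · exact ((hX i).mono hsub).congr fun p hp => by rw [hY p hp]
  · refine ((hJX i).mono hsub).congr fun p hp => ?_
    rw [(transport _ _ (hV p.1 hp.1.2) p.2 (fun i => X i p) (fun i => Y i p) (hY p hp)).1 i]
  · exact (transport _ _ (hV p.1 hp.1.2) p.2 (fun i => X i p) (fun i => Y i p) (hY p hp)).2
      (hspan p (hsub hp))

theorem Homotopic.symm {S T : AlmostContactField n M} (h : Homotopic S T) : Homotopic T S := by
  obtain ⟨A, hA, rfl, rfl⟩ := h
  refine ⟨_, hA.comp (σ := fun t => 1 - t) (contDiff_const.sub contDiff_id)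
    (fun t ht => ⟨by linarith [ht.2], by linarith [ht.1]⟩), by simp, by simp⟩

theorem Homotopic.trans {S T R : AlmostContactField n M} (h : Homotopic S T)
    (h' : Homotopic T R) : Homotopic S R := by
  obtain ⟨A, hA, rfl, rfl⟩ := h
  obtain ⟨B, hB, hAB, rfl⟩ := h'
  -- both families are reparametrized to be constant near the time at which they are glued
  let σ : ℝ → ℝ := fun t => Real.smoothTransition (3 * t)
  let τ : ℝ → ℝ := fun t => Real.smoothTransition (3 * t - 2)
  have hσ : IsSmoothFamily fun t => A (σ t) := hA.comp
    (Real.smoothTransition.contDiff.comp (contDiff_const.mul contDiff_id))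
    fun t _ => ⟨Real.smoothTransition.nonneg _, Real.smoothTransition.le_one _⟩
  have hτ : IsSmoothFamily fun t => B (τ t) := hB.comp
    (Real.smoothTransition.contDiff.comp ((contDiff_const.mul contDiff_id).sub contDiff_const))
    fun t _ => ⟨Real.smoothTransition.nonneg _, Real.smoothTransition.le_one _⟩
  have hσ1 : ∀ t, 1 / 2 < t → σ t = 1 := fun t ht =>
    Real.smoothTransition.one_of_one_le (by linarith)
  have hτ0 : ∀ t, t < 2 / 3 → τ t = 0 := fun t ht =>
    Real.smoothTransition.zero_of_nonpos (by linarith)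
  refine ⟨fun t => if t ≤ 1 / 2 then A (σ t) else B (τ t), isSmoothFamily_of_eventuallyEq ?_,
    ?_, ?_⟩
  · intro t _
    rcases lt_or_ge t (2 / 3) with ht | ht
    · refine ⟨_, hσ, ?_⟩
      filter_upwards [eventually_lt_nhds ht] with s hs
      split_ifs with h
      · rfl
      · rw [hτ0 s hs, hσ1 s (not_le.1 h), hAB]
    · refine ⟨_, hτ, ?_⟩
      filter_upwards [eventually_gt_nhds (show 1 / 2 < t by linarith)] with s hs
      rw [if_neg (not_le.2 hs)]
  · have : σ 0 = 0 := Real.smoothTransition.zero_of_nonpos (by norm_num)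
    simp [this]
  · have : τ 1 = 1 := Real.smoothTransition.one_of_one_le (by norm_num)
    norm_num [this]

/-! ### Transport by diffeomorphisms -/

theorem mem_map_ξ (φ : M ≃ₘ^∞⟮𝓡 (2 * n + 1), 𝓡 (2 * n + 1)⟯ M') (S : AlmostContactField n M)
    (y : M') (v : TangentSpace (𝓡 (2 * n + 1)) y) :
    v ∈ (S.map φ).ξ y ↔
      mfderiv (𝓡 (2 * n + 1)) (𝓡 (2 * n + 1)) φ.symm y v ∈ S.ξ (φ.symm y) := Iff.rfl

theorem mfderiv_symm_map_J (φ : M ≃ₘ^∞⟮𝓡 (2 * n + 1), 𝓡 (2 * n + 1)⟯ M')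
    (S : AlmostContactField n M) (y : M') (v : (S.map φ).ξ y) :
    mfderiv (𝓡 (2 * n + 1)) (𝓡 (2 * n + 1)) φ.symm y ((S.map φ).J y v) =
      S.J (φ.symm y) ⟨mfderiv (𝓡 (2 * n + 1)) (𝓡 (2 * n + 1)) φ.symm y v, v.2⟩ :=
  (φ.symm.mfderivToContinuousLinearEquiv (by simp) y).apply_symm_apply _

theorem map_map_symm (φ : M ≃ₘ^∞⟮𝓡 (2 * n + 1), 𝓡 (2 * n + 1)⟯ M') (T : AlmostContactField n M') :
    (T.map φ.symm).map φ = T := by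
  have hξ : ∀ (y : M') (v : TangentSpace (𝓡 (2 * n + 1)) y),
      v ∈ ((T.map φ.symm).map φ).ξ y ↔ v ∈ T.ξ y := fun y v =>
    iff_of_eq (congrArg (fun q : TangentBundle (𝓡 (2 * n + 1)) M' => q.2 ∈ T.ξ q.1)
      (φ.tangentMap_tangentMap_symm ⟨y, v⟩))
  refine ext_of_forall_mem hξ fun y v hv hT => ?_
  have key : ∀ (q q' : TangentBundle (𝓡 (2 * n + 1)) M') (hq : q.2 ∈ T.ξ q.1)
      (hq' : q'.2 ∈ T.ξ q'.1), q = q' →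
      (⟨q.1, T.J q.1 ⟨q.2, hq⟩⟩ : TangentBundle (𝓡 (2 * n + 1)) M') =
        ⟨q'.1, T.J q'.1 ⟨q'.2, hq'⟩⟩ := by
    rintro q _ hq hq' rfl
    rfl
  have h1 := φ.tangentMap_tangentMap_symm ⟨y, ((T.map φ.symm).map φ).J y ⟨v, hv⟩⟩
  have h2 := key (tangentMap (𝓡 (2 * n + 1)) (𝓡 (2 * n + 1)) φ
    (tangentMap (𝓡 (2 * n + 1)) (𝓡 (2 * n + 1)) φ.symm ⟨y, v⟩)) ⟨y, v⟩ hv hT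
    (φ.tangentMap_tangentMap_symm ⟨y, v⟩)
  have h3 := mfderiv_symm_map_J φ.symm T (φ.symm y)
    ⟨mfderiv (𝓡 (2 * n + 1)) (𝓡 (2 * n + 1)) φ.symm y v, hv⟩
  rw [← mfderiv_symm_map_J φ (T.map φ.symm) y ⟨v, hv⟩] at h3
  have h4 : tangentMap (𝓡 (2 * n + 1)) (𝓡 (2 * n + 1)) φ
      (tangentMap (𝓡 (2 * n + 1)) (𝓡 (2 * n + 1)) φ.symm
        ⟨y, ((T.map φ.symm).map φ).J y ⟨v, hv⟩⟩) = ⟨y, T.J y ⟨v, hT⟩⟩ := by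
    rw [← h2]
    exact congrArg (fun w => (⟨φ (φ.symm y), w⟩ : TangentBundle (𝓡 (2 * n + 1)) M')) h3
  rw [h1] at h4
  exact Bundle.TotalSpace.mk_injective _ h4

/-- A smooth family is carried by `φ` to a smooth family, with the frames `dφ X` and `dφ (J X)`. -/
theorem IsSmoothFamily.map {A : ℝ → AlmostContactField n M} (hA : IsSmoothFamily A)
    (φ : M ≃ₘ^∞⟮𝓡 (2 * n + 1), 𝓡 (2 * n + 1)⟯ M') : IsSmoothFamily fun t => (A t).map φ := by
  rintro ⟨t₀, y₀⟩ ⟨ht₀, -⟩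
  obtain ⟨U, hU, hx₀, X, hX, hJX, hspan⟩ := hA (t₀, φ.symm y₀) ⟨ht₀, mem_univ _⟩
  have hψ : ContMDiff (𝓘(ℝ, ℝ).prod (𝓡 (2 * n + 1))) (𝓘(ℝ, ℝ).prod (𝓡 (2 * n + 1))) ∞
      (fun p : ℝ × M' => (p.1, φ.symm p.2)) :=
    contMDiff_fst.prodMk (φ.symm.contMDiff.comp contMDiff_snd)
  have hmaps : MapsTo (fun p : ℝ × M' => (p.1, φ.symm p.2))
      ((fun p : ℝ × M' => (p.1, φ.symm p.2)) ⁻¹' U ∩ Icc (0 : ℝ) 1 ×ˢ univ)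
      (U ∩ Icc (0 : ℝ) 1 ×ˢ univ) := fun p hp => ⟨hp.1, hp.2.1, mem_univ _⟩
  have hT := φ.contMDiff.contMDiff_tangentMap (m := ∞) (by simp)
  -- the frame is pushed forward by `dφ`, which is the inverse of the differential of `φ⁻¹`
  let e := fun p : ℝ × M' => (φ.symm.mfderivToContinuousLinearEquiv (n := ∞)
    (by simp) p.2).toLinearEquiv.ofSubmodule' ((A p.1).ξ (φ.symm p.2))
  have he : ∀ (p : ℝ × M') (v : (A p.1).ξ (φ.symm p.2)),
      tangentMap (𝓡 (2 * n + 1)) (𝓡 (2 * n + 1)) φ ⟨φ.symm p.2, v⟩ =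
        ⟨p.2, ((e p).symm v : TangentSpace (𝓡 (2 * n + 1)) p.2)⟩ := by
    intro p v
    have h := φ.tangentMap_tangentMap_symm ⟨p.2, (e p).symm v⟩
    have h' : mfderiv (𝓡 (2 * n + 1)) (𝓡 (2 * n + 1)) φ.symm p.2 ((e p).symm v) = v :=
      congrArg Subtype.val ((e p).apply_symm_apply v)
    rw [← h', ← h]
    rfl
  refine ⟨_, hU.preimage hψ.continuous, hx₀, fun i p => (e p).symm (X i (p.1, φ.symm p.2)),
    fun i => ?_, fun i => ?_, fun p hp => ?_⟩
  · refine (hT.comp_contMDiffOn ((hX i).comp hψ.contMDiffOn hmaps)).congr fun p _ => ?_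
    exact (he p _).symm
  · refine (hT.comp_contMDiffOn ((hJX i).comp hψ.contMDiffOn hmaps)).congr fun p _ => ?_
    refine Eq.trans ?_ (he p _).symm
    congr 2
    change (e p).symm ((A p.1).J _ (e p ((e p).symm _))) = _
    rw [LinearEquiv.apply_symm_apply]
  · have h := hspan _ (hmaps hp)
    change Submodule.span ℝ (range ((e p).symm ∘ fun i => X i (p.1, φ.symm p.2))) = ⊤
    rw [range_comp, ← LinearEquiv.coe_coe, Submodule.span_image, h, Submodule.map_top,
      LinearEquiv.range]

theorem map_symm_map (φ : M ≃ₘ^∞⟮𝓡 (2 * n + 1), 𝓡 (2 * n + 1)⟯ M') (S : AlmostContactField n M) :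
    (S.map φ).map φ.symm = S :=
  map_map_symm φ.symm S

theorem IsSmooth.map {S : AlmostContactField n M} (hS : S.IsSmooth)
    (φ : M ≃ₘ^∞⟮𝓡 (2 * n + 1), 𝓡 (2 * n + 1)⟯ M') : (S.map φ).IsSmooth :=
  (hS.isSmoothFamily_const.map φ).isSmooth (t := 0) (by simp)

theorem Homotopic.map {S T : AlmostContactField n M} (h : Homotopic S T)
    (φ : M ≃ₘ^∞⟮𝓡 (2 * n + 1), 𝓡 (2 * n + 1)⟯ M') : Homotopic (S.map φ) (T.map φ) := by
  obtain ⟨A, hA, rfl, rfl⟩ := h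
  exact ⟨_, hA.map φ, rfl, rfl⟩

end

end AlmostContactField

/-! ### Vector fields along a map in a local trivialization -/

section

variable {E H N : Type*} [NormedAddCommGroup E] [NormedSpace ℝ E] [TopologicalSpace H]
  {I : ModelWithCorners ℝ E H} [TopologicalSpace N] [ChartedSpace H N]
  {a : ℕ} {M : Type*} [TopologicalSpace M] [ChartedSpace (EuclideanSpace ℝ (Fin a)) M]
  [IsManifold (𝓡 a) ∞ M] {s : Set N} {p : N} {g : N → M}

/-- A vector field along `g` with smooth coordinates in a trivialization is smooth. -/
theorem ContMDiffWithinAt.tangent_symmL {c : N → EuclideanSpace ℝ (Fin a)}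
    (hg : ContMDiffWithinAt I (𝓡 a) ∞ g s p)
    (hc : ContMDiffWithinAt I 𝓘(ℝ, EuclideanSpace ℝ (Fin a)) ∞ c s p) (x₀ : M)
    (hp : g p ∈ (trivializationAt (EuclideanSpace ℝ (Fin a)) (TangentSpace (𝓡 a)) x₀).baseSet) :
    ContMDiffWithinAt I (𝓡 a).tangent ∞ (fun q =>
      (⟨g q, (trivializationAt (EuclideanSpace ℝ (Fin a)) (TangentSpace (𝓡 a)) x₀).symmL ℝ (g q)
        (c q)⟩ : TangentBundle (𝓡 a) M)) s p := by
  set e := trivializationAt (EuclideanSpace ℝ (Fin a)) (TangentSpace (𝓡 a) : M → Type _) x₀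
  have hmem : ∀ᶠ q in 𝓝[insert p s] p, g q ∈ e.baseSet := by
    have : ContinuousWithinAt g (insert p s) p := hg.continuousWithinAt.insert
    exact this (e.open_baseSet.mem_nhds hp)
  rw [← contMDiffWithinAt_insert_self] at hg hc ⊢
  rw [e.contMDiffWithinAt_iff (IB := 𝓡 a) (by rwa [e.mem_source])]
  refine ⟨hg, hc.congr_of_eventuallyEq_of_mem ?_ (mem_insert _ _)⟩
  filter_upwards [hmem] with q hq
  rw [← e.continuousLinearMapAt_apply_of_mem (R := ℝ) hq, e.continuousLinearMapAt_symmL hq]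

/-- The coordinates of a smooth vector field along `g` in a trivialization are smooth. -/
theorem ContMDiffWithinAt.tangent_continuousLinearMapAt {Z : ∀ q, TangentSpace (𝓡 a) (g q)}
    (hZ : ContMDiffWithinAt I (𝓡 a).tangent ∞ (fun q => (⟨g q, Z q⟩ : TangentBundle (𝓡 a) M)) s p)
    (x₀ : M)
    (hp : g p ∈ (trivializationAt (EuclideanSpace ℝ (Fin a)) (TangentSpace (𝓡 a)) x₀).baseSet) :
    ContMDiffWithinAt I 𝓘(ℝ, EuclideanSpace ℝ (Fin a)) ∞ (fun q =>
      (trivializationAt (EuclideanSpace ℝ (Fin a)) (TangentSpace (𝓡 a)) x₀).continuousLinearMapAt ℝ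
        (g q) (Z q)) s p := by
  set e := trivializationAt (EuclideanSpace ℝ (Fin a)) (TangentSpace (𝓡 a) : M → Type _) x₀
  rw [← contMDiffWithinAt_insert_self] at hZ ⊢
  rw [e.contMDiffWithinAt_iff (IB := 𝓡 a) (by rwa [e.mem_source])] at hZ
  have hmem : ∀ᶠ q in 𝓝[insert p s] p, g q ∈ e.baseSet :=
    hZ.1.continuousWithinAt (e.open_baseSet.mem_nhds hp)
  refine hZ.2.congr_of_eventuallyEq_of_mem ?_ (mem_insert _ _)
  filter_upwards [hmem] with q hq
  rw [e.continuousLinearMapAt_apply_of_mem (R := ℝ) hq]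

end

/-! ### Hyperplane fields that are kernels of smooth forms -/

/-- A spanning family of one hyperplane is moved, by projecting along a transverse vector, to a
spanning family of another. -/
theorem LinearMap.ker_le_span_range_sub_smul {V V' ι : Type*} [AddCommGroup V] [Module ℝ V]
    [AddCommGroup V'] [Module ℝ V'] {θ : V →ₗ[ℝ] ℝ} {b : ι → V}
    (hb : LinearMap.ker θ ≤ Submodule.span ℝ (Set.range b)) {w : V} (hw : θ w ≠ 0) {ε : V →ₗ[ℝ] V'}
    (hε : Function.Surjective ε) {θ' : V' →ₗ[ℝ] ℝ} (hw' : θ' (ε w) ≠ 0) :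
    LinearMap.ker θ' ≤
      Submodule.span ℝ (Set.range fun i => ε (b i - (θ' (ε (b i)) / θ' (ε w)) • w)) := by
  intro v hv
  obtain ⟨u, rfl⟩ := hε v
  let P : V →ₗ[ℝ] V' :=
    ε ∘ₗ (LinearMap.id - ((θ' (ε w))⁻¹ • (θ' ∘ₗ ε)).smulRight w)
  have hP : ∀ z, P z = ε (z - (θ' (ε z) / θ' (ε w)) • w) := fun z => by
    simp [P, div_eq_inv_mul]
  have hu : u - (θ u / θ w) • w ∈ Submodule.span ℝ (Set.range b) := hb (by simp [hw])
  have h := Submodule.mem_map_of_mem (f := P) hu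
  rw [Submodule.map_span, ← Set.range_comp] at h
  have hPw : P w = 0 := by simp [hP, hw']
  have hPu : P u = ε u := by simp [hP, LinearMap.mem_ker.1 hv]
  rw [map_sub, map_smul, hPw, hPu, smul_zero, sub_zero] at h
  convert h using 3
  exact funext fun i => (hP (b i)).symm

namespace AlmostContactField

/-- A family of almost contact structures is smooth if locally its hyperplanes are the kernels of
a smooth family of `1`-forms `θ` and its complex multiplications are the restrictions of a smooth
family `κ` of endomorphisms. Smoothness of `θ` and `κ` is expressed through their values on smooth
vector fields. -/
theorem isSmoothFamily_of_ker {n : ℕ}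
    {M : Type*} [TopologicalSpace M] [ChartedSpace (EuclideanSpace ℝ (Fin (2 * n + 1))) M]
    [IsManifold (𝓡 (2 * n + 1)) ∞ M] {A : ℝ → AlmostContactField n M}
    (h : ∀ p₀ ∈ Icc (0 : ℝ) 1 ×ˢ (univ : Set M),
      ∃ (θ : ∀ p : ℝ × M, TangentSpace (𝓡 (2 * n + 1)) p.2 →ₗ[ℝ] ℝ)
        (κ : ∀ p : ℝ × M, TangentSpace (𝓡 (2 * n + 1)) p.2 →ₗ[ℝ] TangentSpace (𝓡 (2 * n + 1)) p.2),
        ∀ᶠ p in 𝓝[Icc (0 : ℝ) 1 ×ˢ univ] p₀,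
          (∀ v, v ∈ (A p.1).ξ p.2 ↔ θ p v = 0) ∧
          (∀ v : (A p.1).ξ p.2, ((A p.1).J p.2 v : TangentSpace (𝓡 (2 * n + 1)) p.2) = κ p v) ∧
          ∀ Y : ∀ q : ℝ × M, TangentSpace (𝓡 (2 * n + 1)) q.2,
            ContMDiffWithinAt (𝓘(ℝ, ℝ).prod (𝓡 (2 * n + 1))) (𝓡 (2 * n + 1)).tangent ∞
              (fun q => (⟨q.2, Y q⟩ : TangentBundle (𝓡 (2 * n + 1)) M))
              (Icc (0 : ℝ) 1 ×ˢ univ) p →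
            ContMDiffWithinAt (𝓘(ℝ, ℝ).prod (𝓡 (2 * n + 1))) 𝓘(ℝ, ℝ) ∞ (fun q => θ q (Y q))
              (Icc (0 : ℝ) 1 ×ˢ univ) p ∧
            ContMDiffWithinAt (𝓘(ℝ, ℝ).prod (𝓡 (2 * n + 1))) (𝓡 (2 * n + 1)).tangent ∞
              (fun q => (⟨q.2, κ q (Y q)⟩ : TangentBundle (𝓡 (2 * n + 1)) M))
              (Icc (0 : ℝ) 1 ×ˢ univ) p) :
    IsSmoothFamily A := by
  classical
  intro p₀ hp₀
  obtain ⟨θ, κ, hev⟩ := h p₀ hp₀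
  obtain ⟨hξ₀, -, hsm₀⟩ := hev.self_of_nhdsWithin hp₀
  set e := trivializationAt (EuclideanSpace ℝ (Fin (2 * n + 1)))
    (TangentSpace (𝓡 (2 * n + 1)) : M → Type _) p₀.2
  have he₀ : p₀.2 ∈ e.baseSet := FiberBundle.mem_baseSet_trivializationAt' p₀.2
  have hbase : ∀ᶠ p in 𝓝[Icc (0 : ℝ) 1 ×ˢ (univ : Set M)] p₀, p.2 ∈ e.baseSet :=
    continuous_snd.continuousAt.continuousWithinAt (e.open_baseSet.mem_nhds he₀)
  -- the fields with constant coordinates are smooth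
  have hconst : ∀ (c : EuclideanSpace ℝ (Fin (2 * n + 1))) (p : ℝ × M), p.2 ∈ e.baseSet →
      ContMDiffWithinAt (𝓘(ℝ, ℝ).prod (𝓡 (2 * n + 1))) (𝓡 (2 * n + 1)).tangent ∞
        (fun q => (⟨q.2, e.symmL ℝ q.2 c⟩ : TangentBundle (𝓡 (2 * n + 1)) M))
        (Icc (0 : ℝ) 1 ×ˢ univ) p := fun c p hp =>
    contMDiffWithinAt_snd.tangent_symmL contMDiffWithinAt_const p₀.2 hp
  -- in coordinates at `p₀`: a basis `b` of the hyperplane and a vector `w` transverse to it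
  let θ₀ : EuclideanSpace ℝ (Fin (2 * n + 1)) →ₗ[ℝ] ℝ := θ p₀ ∘ₗ (e.symmL ℝ p₀.2).toLinearMap
  let β : Basis (Fin (2 * n)) ℝ ((A p₀.1).ξ p₀.2) := by
    haveI : FiniteDimensional ℝ (TangentSpace (𝓡 (2 * n + 1)) p₀.2) :=
      inferInstanceAs (FiniteDimensional ℝ (EuclideanSpace ℝ (Fin (2 * n + 1))))
    exact finBasisOfFinrankEq ℝ _ ((A p₀.1).finrank_ξ p₀.2)
  let b : Fin (2 * n) → EuclideanSpace ℝ (Fin (2 * n + 1)) := fun i =>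
    e.continuousLinearMapAt ℝ p₀.2 (β i)
  have hb : LinearMap.ker θ₀ ≤ Submodule.span ℝ (range b) := by
    intro c hc
    have hmem := (hξ₀ (e.symmL ℝ p₀.2 c)).2 hc
    have h1 := Submodule.mem_map_of_mem
      (f := (e.continuousLinearMapAt ℝ p₀.2).toLinearMap ∘ₗ ((A p₀.1).ξ p₀.2).subtype)
      (β.mem_span (⟨_, hmem⟩ : (A p₀.1).ξ p₀.2))
    rw [Submodule.map_span, ← range_comp] at h1
    have h2 : e.continuousLinearMapAt ℝ p₀.2 (e.symmL ℝ p₀.2 c) = c :=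
      e.continuousLinearMapAt_symmL he₀ c
    rw [← h2]
    exact h1
  obtain ⟨w, hw⟩ : ∃ w, θ₀ w ≠ 0 := by
    by_contra! hcon
    have htop : (A p₀.1).ξ p₀.2 = ⊤ := by
      refine Submodule.eq_top_iff'.2 fun v => (hξ₀ v).2 ?_
      rw [← e.symmL_continuousLinearMapAt (R := ℝ) he₀ v]
      exact hcon _
    have h1 := (A p₀.1).finrank_ξ p₀.2
    rw [htop, finrank_top] at h1
    have h2 : finrank ℝ (TangentSpace (𝓡 (2 * n + 1)) p₀.2) = 2 * n + 1 := finrank_euclideanSpace_fin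
    omega
  have hwev : ∀ᶠ p in 𝓝[Icc (0 : ℝ) 1 ×ˢ (univ : Set M)] p₀, θ p (e.symmL ℝ p.2 w) ≠ 0 :=
    (hsm₀ _ (hconst w p₀ he₀)).1.continuousWithinAt.eventually_ne hw
  obtain ⟨U, hU, hpU, hUsub⟩ := mem_nhdsWithin.1 ((hev.and hbase).and hwev)
  -- the coordinates of the frame
  let c : Fin (2 * n) → ℝ × M → EuclideanSpace ℝ (Fin (2 * n + 1)) := fun i p =>
    b i - (θ p (e.symmL ℝ p.2 (b i)) / θ p (e.symmL ℝ p.2 w)) • w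
  have hcθ : ∀ i, ∀ p ∈ U ∩ Icc (0 : ℝ) 1 ×ˢ univ, θ p (e.symmL ℝ p.2 (c i p)) = 0 := by
    intro i p hp
    have := (hUsub hp).2
    simp [c, this]
  let X : Fin (2 * n) → ∀ p : ℝ × M, (A p.1).ξ p.2 := fun i p =>
    if hp : e.symmL ℝ p.2 (c i p) ∈ (A p.1).ξ p.2 then ⟨_, hp⟩ else 0
  have hX : ∀ i, ∀ p ∈ U ∩ Icc (0 : ℝ) 1 ×ˢ univ,
      (X i p : TangentSpace (𝓡 (2 * n + 1)) p.2) = e.symmL ℝ p.2 (c i p) := fun i p hp => by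
    have : e.symmL ℝ p.2 (c i p) ∈ (A p.1).ξ p.2 :=
      ((hUsub hp).1.1.1 _).2 (hcθ i p hp)
    simp only [X, dif_pos this]
  have hsmooth : ∀ i, ∀ p ∈ U ∩ Icc (0 : ℝ) 1 ×ˢ univ,
      ContMDiffWithinAt (𝓘(ℝ, ℝ).prod (𝓡 (2 * n + 1))) (𝓡 (2 * n + 1)).tangent ∞
        (fun q => (⟨q.2, e.symmL ℝ q.2 (c i q)⟩ : TangentBundle (𝓡 (2 * n + 1)) M))
        (Icc (0 : ℝ) 1 ×ˢ univ) p := by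
    intro i p hp
    obtain ⟨⟨⟨-, -, hsm⟩, hpe⟩, hpw⟩ := hUsub hp
    have hquot := (hsm _ (hconst (b i) p hpe)).1.div₀ (hsm _ (hconst w p hpe)).1 hpw
    exact contMDiffWithinAt_snd.tangent_symmL
      (contMDiffWithinAt_const.sub (hquot.smul contMDiffWithinAt_const)) p₀.2 hpe
  refine ⟨U, hU, hpU, X, fun i p hp => ?_, fun i p hp => ?_, fun p hp => ?_⟩
  · refine ((hsmooth i p hp).mono inter_subset_right).congr (fun q hq => ?_) ?_
    · rw [hX i q hq]
    · rw [hX i p hp]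
  · have hκ := ((hUsub hp).1.1.2.2 _ (hsmooth i p hp)).2
    refine (hκ.mono inter_subset_right).congr (fun q hq => ?_) ?_
    · rw [(hUsub hq).1.1.2.1 (X i q), hX i q hq]
    · rw [(hUsub hp).1.1.2.1 (X i p), hX i p hp]
  · obtain ⟨⟨⟨hξ, -, -⟩, hpe⟩, hpw⟩ := hUsub hp
    have hsurj : Function.Surjective (e.symmL ℝ p.2).toLinearMap := fun v =>
      ⟨_, e.symmL_continuousLinearMapAt (R := ℝ) hpe v⟩
    have hle := LinearMap.ker_le_span_range_sub_smul hb hw hsurj (θ' := θ p) hpw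
    refine Submodule.eq_top_iff'.2 fun v => ?_
    have hv := hle (LinearMap.mem_ker.2 ((hξ v.1).1 v.2))
    have hrange : (range fun i => (e.symmL ℝ p.2).toLinearMap (c i p)) =
        ((A p.1).ξ p.2).subtype '' range fun i => X i p := by
      rw [← range_comp]
      exact congrArg range (funext fun i => (hX i p hp).symm)
    change (v : TangentSpace (𝓡 (2 * n + 1)) p.2) ∈
      Submodule.span ℝ (range fun i => (e.symmL ℝ p.2).toLinearMap (c i p)) at hv
    rw [hrange, ← Submodule.map_span] at hv
    obtain ⟨u, hu, huv⟩ := hv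
    rwa [← Subtype.ext huv]

end AlmostContactField

/-! ### Smooth families of immersed hypersurfaces -/

theorem contMDiffWithinAt_clm_of_apply {E H N : Type*} [NormedAddCommGroup E] [NormedSpace ℝ E]
    [TopologicalSpace H] {I : ModelWithCorners ℝ E H} [TopologicalSpace N] [ChartedSpace H N]
    {F G : Type*} [NormedAddCommGroup F] [NormedSpace ℝ F] [FiniteDimensional ℝ F]
    [NormedAddCommGroup G] [NormedSpace ℝ G] [FiniteDimensional ℝ G] {k : ℕ∞ω}
    {f : N → F →L[ℝ] G} {s : Set N} {p : N}
    (hf : ∀ v, ContMDiffWithinAt I 𝓘(ℝ, G) k (fun q => f q v) s p) :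
    ContMDiffWithinAt I 𝓘(ℝ, F →L[ℝ] G) k f s p := by
  let b := finBasis ℝ F
  -- a linear map is a linear function of its values on a basis
  let Φ : (Fin (finrank ℝ F) → G) →ₗ[ℝ] (F →L[ℝ] G) :=
    LinearMap.toContinuousLinearMap.toLinearMap ∘ₗ (b.constr ℝ).toLinearMap
  have h : ContMDiffWithinAt I 𝓘(ℝ, Fin (finrank ℝ F) → G) k (fun q i => f q (b i)) s p :=
    contMDiffWithinAt_pi_space.2 fun i => hf (b i)
  have hΦ : (fun q => Φ.toContinuousLinearMap fun i => f q (b i)) = f := by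
    funext q
    refine ContinuousLinearMap.coe_injective (b.ext fun i => ?_)
    exact b.constr_basis ℝ _ i
  rw [← hΦ]
  exact Φ.toContinuousLinearMap.contMDiff.contMDiffAt.comp_contMDiffWithinAt p h

section

variable {a b : ℕ}
  {M : Type*} [TopologicalSpace M] [ChartedSpace (EuclideanSpace ℝ (Fin a)) M]
  [IsManifold (𝓡 a) ∞ M]
  {W : Type*} [TopologicalSpace W] [ChartedSpace (EuclideanSpace ℝ (Fin b)) W]
  [IsManifold (𝓡 b) ∞ W] {F : ℝ → M → W}

/-- The differentials of a smooth family of maps carry smooth families of vector fields to smooth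
families of vector fields along the maps. -/
theorem ContMDiffOn.mfderiv_family_apply
    (hF : ContMDiffOn (𝓘(ℝ, ℝ).prod (𝓡 a)) (𝓡 b) ∞ (fun p : ℝ × M => F p.1 p.2)
      (Icc (0 : ℝ) 1 ×ˢ univ)) {p : ℝ × M} (hp : p ∈ Icc (0 : ℝ) 1 ×ˢ (univ : Set M))
    {Y : ∀ q : ℝ × M, TangentSpace (𝓡 a) q.2}
    (hY : ContMDiffWithinAt (𝓘(ℝ, ℝ).prod (𝓡 a)) (𝓡 a).tangent ∞
      (fun q => (⟨q.2, Y q⟩ : TangentBundle (𝓡 a) M)) (Icc (0 : ℝ) 1 ×ˢ univ) p) :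
    ContMDiffWithinAt (𝓘(ℝ, ℝ).prod (𝓡 a)) (𝓡 b).tangent ∞
      (fun q => (⟨F q.1 q.2, mfderiv (𝓡 a) (𝓡 b) (F q.1) q.2 (Y q)⟩ : TangentBundle (𝓡 b) W))
      (Icc (0 : ℝ) 1 ×ˢ univ) p := by
  have huncurry : ContMDiffWithinAt ((𝓘(ℝ, ℝ).prod (𝓡 a)).prod (𝓡 a)) (𝓡 b) ∞
      (Function.uncurry fun (q : ℝ × M) (y : M) => F q.1 y)
      ((Icc (0 : ℝ) 1 ×ˢ univ) ×ˢ univ) (p, p.2) := by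
    have hproj : ContMDiff ((𝓘(ℝ, ℝ).prod (𝓡 a)).prod (𝓡 a)) (𝓘(ℝ, ℝ).prod (𝓡 a)) ∞
        (fun z : (ℝ × M) × M => (z.1.1, z.2)) :=
      (contMDiff_fst.comp contMDiff_fst).prodMk contMDiff_snd
    have hmaps : MapsTo (fun z : (ℝ × M) × M => (z.1.1, z.2))
        ((Icc (0 : ℝ) 1 ×ˢ univ) ×ˢ univ) (Icc (0 : ℝ) 1 ×ˢ univ) :=
      fun z hz => ⟨hz.1.1, mem_univ _⟩
    exact ContMDiffWithinAt.comp (g := fun q : ℝ × M => F q.1 q.2) (p, p.2) (hF p hp)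
      hproj.contMDiffAt.contMDiffWithinAt hmaps
  have hd := huncurry.mfderivWithin (m := ∞) (g := Prod.snd) contMDiffWithinAt_snd hp
    (mapsTo_univ _ _) (by simp) uniqueMDiffOn_univ
  simp only [mfderivWithin_univ] at hd
  exact ContMDiffWithinAt.clm_apply_of_inCoordinates
    (E₁ := (TangentSpace (𝓡 a) : M → Type _)) (E₂ := (TangentSpace (𝓡 b) : W → Type _))
    (b₁ := fun q : ℝ × M => q.2) (b₂ := fun q => F q.1 q.2)
    (ϕ := fun q => mfderiv (𝓡 a) (𝓡 b) (F q.1) q.2) (v := Y) hd hY (hF p hp)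

/-- Locally, a smooth family of immersed hypersurfaces has a smooth family of normal `1`-forms `ν`
(with kernel the tangent spaces) and of projections `π` onto the tangent spaces. -/
theorem exists_normal_form_and_projection (hab : b = a + 1)
    (hF : ContMDiffOn (𝓘(ℝ, ℝ).prod (𝓡 a)) (𝓡 b) ∞ (fun p : ℝ × M => F p.1 p.2)
      (Icc (0 : ℝ) 1 ×ˢ univ))
    {p₀ : ℝ × M} (hp₀ : p₀ ∈ Icc (0 : ℝ) 1 ×ˢ (univ : Set M))
    (hinj : Function.Injective (mfderiv (𝓡 a) (𝓡 b) (F p₀.1) p₀.2)) :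
    ∃ (ν : ∀ p : ℝ × M, TangentSpace (𝓡 b) (F p.1 p.2) →ₗ[ℝ] ℝ)
      (π : ∀ p : ℝ × M, TangentSpace (𝓡 b) (F p.1 p.2) →ₗ[ℝ] TangentSpace (𝓡 a) p.2),
      ∀ᶠ p in 𝓝[Icc (0 : ℝ) 1 ×ˢ univ] p₀,
        (∀ z, ν p z = 0 ↔ ∃ v, mfderiv (𝓡 a) (𝓡 b) (F p.1) p.2 v = z) ∧
        (∀ v, π p (mfderiv (𝓡 a) (𝓡 b) (F p.1) p.2 v) = v) ∧
        ∀ Z : ∀ q : ℝ × M, TangentSpace (𝓡 b) (F q.1 q.2),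
          ContMDiffWithinAt (𝓘(ℝ, ℝ).prod (𝓡 a)) (𝓡 b).tangent ∞
            (fun q => (⟨F q.1 q.2, Z q⟩ : TangentBundle (𝓡 b) W)) (Icc (0 : ℝ) 1 ×ˢ univ) p →
          ContMDiffWithinAt (𝓘(ℝ, ℝ).prod (𝓡 a)) 𝓘(ℝ, ℝ) ∞ (fun q => ν q (Z q))
            (Icc (0 : ℝ) 1 ×ˢ univ) p ∧
          ContMDiffWithinAt (𝓘(ℝ, ℝ).prod (𝓡 a)) (𝓡 a).tangent ∞
            (fun q => (⟨q.2, π q (Z q)⟩ : TangentBundle (𝓡 a) M)) (Icc (0 : ℝ) 1 ×ˢ univ) p := by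
  set e := trivializationAt (EuclideanSpace ℝ (Fin a)) (TangentSpace (𝓡 a) : M → Type _) p₀.2
  set e' := trivializationAt (EuclideanSpace ℝ (Fin b)) (TangentSpace (𝓡 b) : W → Type _)
    (F p₀.1 p₀.2)
  have he₀ : p₀.2 ∈ e.baseSet := FiberBundle.mem_baseSet_trivializationAt' p₀.2
  have he₀' : F p₀.1 p₀.2 ∈ e'.baseSet := FiberBundle.mem_baseSet_trivializationAt' (F p₀.1 p₀.2)
  -- the differential in coordinates
  let D : ℝ × M → EuclideanSpace ℝ (Fin a) →L[ℝ] EuclideanSpace ℝ (Fin b) := fun p =>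
    (e'.continuousLinearMapAt ℝ (F p.1 p.2)).comp
      ((mfderiv (𝓡 a) (𝓡 b) (F p.1) p.2).comp (e.symmL ℝ p.2))
  have hDv : ∀ p v, p.2 ∈ e.baseSet → D p (e.continuousLinearMapAt ℝ p.2 v) =
      e'.continuousLinearMapAt ℝ (F p.1 p.2) (mfderiv (𝓡 a) (𝓡 b) (F p.1) p.2 v) :=
    fun p v hp => by
      simp only [D, ContinuousLinearMap.comp_apply]
      rw [e.symmL_continuousLinearMapAt hp]
  have hD : ∀ p ∈ Icc (0 : ℝ) 1 ×ˢ (univ : Set M), p.2 ∈ e.baseSet → F p.1 p.2 ∈ e'.baseSet →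
      ∀ c, ContMDiffWithinAt (𝓘(ℝ, ℝ).prod (𝓡 a)) 𝓘(ℝ, EuclideanSpace ℝ (Fin b)) ∞
        (fun q => D q c) (Icc (0 : ℝ) 1 ×ˢ univ) p := fun p hp hpe hpe' c =>
    (hF.mfderiv_family_apply hp (contMDiffWithinAt_snd.tangent_symmL contMDiffWithinAt_const
      p₀.2 hpe)).tangent_continuousLinearMapAt (F p₀.1 p₀.2) hpe'
  have hD₀ : Function.Injective (D p₀) := by
    intro c c' h
    have h1 := congrArg (e'.symmL ℝ (F p₀.1 p₀.2)) h
    simp only [D, ContinuousLinearMap.comp_apply] at h1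
    rw [e'.symmL_continuousLinearMapAt he₀', e'.symmL_continuousLinearMapAt he₀'] at h1
    have h2 := congrArg (e.continuousLinearMapAt ℝ p₀.2) (hinj h1)
    rwa [e.continuousLinearMapAt_symmL he₀, e.continuousLinearMapAt_symmL he₀] at h2
  -- a vector that is transverse to the hypersurface at `p₀`
  obtain ⟨u, hu⟩ : ∃ u, u ∉ LinearMap.range (D p₀).toLinearMap := by
    by_contra! hcon
    have h1 := LinearMap.finrank_range_of_inj (f := (D p₀).toLinearMap) hD₀
    rw [Submodule.eq_top_iff'.2 hcon, finrank_top, finrank_euclideanSpace_fin,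
      finrank_euclideanSpace_fin] at h1
    omega
  let B : ℝ × M → EuclideanSpace ℝ (Fin a) × ℝ →L[ℝ] EuclideanSpace ℝ (Fin b) := fun p =>
    (D p).coprod (ContinuousLinearMap.toSpanSingleton ℝ u)
  have hBapp : ∀ p c, B p c = D p c.1 + c.2 • u := fun p c => by
    simp [B]
  have hB : ∀ p ∈ Icc (0 : ℝ) 1 ×ˢ (univ : Set M), p.2 ∈ e.baseSet → F p.1 p.2 ∈ e'.baseSet →
      ContMDiffWithinAt (𝓘(ℝ, ℝ).prod (𝓡 a))
        𝓘(ℝ, EuclideanSpace ℝ (Fin a) × ℝ →L[ℝ] EuclideanSpace ℝ (Fin b)) ∞ B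
        (Icc (0 : ℝ) 1 ×ˢ univ) p := fun p hp hpe hpe' =>
    contMDiffWithinAt_clm_of_apply fun c => by
      simp only [hBapp]
      exact (hD p hp hpe hpe' c.1).add contMDiffWithinAt_const
  have hB₀ : B p₀ ∈ range ((↑) : ((EuclideanSpace ℝ (Fin a) × ℝ) ≃L[ℝ] EuclideanSpace ℝ (Fin b)) →
      EuclideanSpace ℝ (Fin a) × ℝ →L[ℝ] EuclideanSpace ℝ (Fin b)) := by
    have hBinj : Function.Injective (B p₀).toLinearMap := by
      rw [← LinearMap.ker_eq_bot, LinearMap.ker_eq_bot']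
      rintro ⟨c, r⟩ h
      have h' : D p₀ c + r • u = 0 := by rw [← h]; exact (hBapp p₀ (c, r)).symm
      have hr : r = 0 := by
        by_contra hr
        refine hu ⟨-r⁻¹ • c, ?_⟩
        have h2 : D p₀ c = -(r • u) := eq_neg_of_add_eq_zero_left h'
        change D p₀ (-r⁻¹ • c) = u
        rw [map_smul, h2, neg_smul_neg, smul_smul, inv_mul_cancel₀ hr, one_smul]
      subst hr
      have hc : c = 0 := hD₀ (by simpa using h')
      rw [hc]; rfl
    refine ⟨(LinearMap.linearEquivOfInjective (B p₀).toLinearMap hBinj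
      (by simp [hab])).toContinuousLinearEquiv, ?_⟩
    exact ContinuousLinearMap.ext fun c => rfl
  have hmem : ∀ᶠ p in 𝓝[Icc (0 : ℝ) 1 ×ˢ (univ : Set M)] p₀, p.2 ∈ e.baseSet :=
    continuous_snd.continuousAt.continuousWithinAt (e.open_baseSet.mem_nhds he₀)
  have hmem' : ∀ᶠ p in 𝓝[Icc (0 : ℝ) 1 ×ˢ (univ : Set M)] p₀, F p.1 p.2 ∈ e'.baseSet :=
    (hF p₀ hp₀).continuousWithinAt (e'.open_baseSet.mem_nhds he₀')
  have hinv : ∀ᶠ p in 𝓝[Icc (0 : ℝ) 1 ×ˢ (univ : Set M)] p₀, B p ∈ range ((↑) :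
      ((EuclideanSpace ℝ (Fin a) × ℝ) ≃L[ℝ] EuclideanSpace ℝ (Fin b)) →
        EuclideanSpace ℝ (Fin a) × ℝ →L[ℝ] EuclideanSpace ℝ (Fin b)) :=
    (hB p₀ hp₀ he₀ he₀').continuousWithinAt (ContinuousLinearEquiv.isOpen.mem_nhds hB₀)
  refine ⟨fun p => LinearMap.snd ℝ _ _ ∘ₗ (B p).inverse.toLinearMap ∘ₗ
      (e'.continuousLinearMapAt ℝ (F p.1 p.2)).toLinearMap,
    fun p => (e.symmL ℝ p.2).toLinearMap ∘ₗ LinearMap.fst ℝ _ _ ∘ₗ (B p).inverse.toLinearMap ∘ₗ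
      (e'.continuousLinearMapAt ℝ (F p.1 p.2)).toLinearMap, ?_⟩
  filter_upwards [hmem, hmem', hinv, self_mem_nhdsWithin] with p hpe hpe' ⟨Φ, hΦ⟩ hp
  have hBi : (B p).inverse = Φ.symm := by rw [← hΦ, ContinuousLinearMap.inverse_equiv]
  have hdF : ∀ v, (B p).inverse (e'.continuousLinearMapAt ℝ (F p.1 p.2)
      (mfderiv (𝓡 a) (𝓡 b) (F p.1) p.2 v)) = (e.continuousLinearMapAt ℝ p.2 v, 0) := by
    intro v
    rw [hBi]
    refine Φ.symm_apply_eq.2 ?_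
    rw [← ContinuousLinearEquiv.coe_coe, hΦ, hBapp, ← hDv p v hpe, zero_smul, add_zero]
  refine ⟨fun z => ⟨fun hz => ?_, ?_⟩, fun v => ?_, fun Z hZ => ?_⟩
  · set c := (B p).inverse (e'.continuousLinearMapAt ℝ (F p.1 p.2) z) with hc
    have hz : c.2 = 0 := hz
    refine ⟨e.symmL ℝ p.2 c.1, ?_⟩
    have h1 : B p c = e'.continuousLinearMapAt ℝ (F p.1 p.2) z := by
      rw [hc, hBi, ← hΦ]
      exact Φ.apply_symm_apply _
    rw [hBapp, hz, zero_smul, add_zero] at h1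
    have h2 := congrArg (e'.symmL ℝ (F p.1 p.2)) h1
    simp only [D, ContinuousLinearMap.comp_apply] at h2
    rwa [e'.symmL_continuousLinearMapAt hpe', e'.symmL_continuousLinearMapAt hpe'] at h2
  · rintro ⟨v, rfl⟩
    exact congrArg Prod.snd (hdF v)
  · exact (congrArg (fun c => e.symmL ℝ p.2 c.1) (hdF v)).trans
      (e.symmL_continuousLinearMapAt hpe v)
  · have hcoord := hZ.tangent_continuousLinearMapAt (F p₀.1 p₀.2) hpe'
    have hBinv : ContMDiffWithinAt (𝓘(ℝ, ℝ).prod (𝓡 a))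
        𝓘(ℝ, EuclideanSpace ℝ (Fin b) →L[ℝ] EuclideanSpace ℝ (Fin a) × ℝ) ∞
        (fun q => (B q).inverse) (Icc (0 : ℝ) 1 ×ˢ univ) p := by
      have h1 : ContDiffAt ℝ ∞ ContinuousLinearMap.inverse (B p) := by
        rw [← hΦ]
        exact contDiffAt_map_inverse Φ
      exact h1.contMDiffAt.comp_contMDiffWithinAt p (hB p hp hpe hpe')
    have happ := hBinv.clm_apply hcoord
    exact ⟨contDiff_snd.contMDiff.contMDiffAt.comp_contMDiffWithinAt p happ,
      contMDiffWithinAt_snd.tangent_symmL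
        (contDiff_fst.contMDiff.contMDiffAt.comp_contMDiffWithinAt p happ) p₀.2 hpe⟩

end

/-! ### Isotopies of hypersurfaces in an almost complex manifold -/

section

variable {n : ℕ}
  {W : Type*} [TopologicalSpace W] [ChartedSpace (EuclideanSpace ℝ (Fin (2 * n + 2))) W]
  [IsManifold (𝓡 (2 * n + 2)) ∞ W] (J : AlmostComplexStructure (2 * n + 2) W)
  {M : Type*} [TopologicalSpace M] [ChartedSpace (EuclideanSpace ℝ (Fin (2 * n + 1))) M]
  [IsManifold (𝓡 (2 * n + 1)) ∞ M]
  {M' : Type*} [TopologicalSpace M'] [ChartedSpace (EuclideanSpace ℝ (Fin (2 * n + 1))) M']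
  [IsManifold (𝓡 (2 * n + 1)) ∞ M']

namespace AlmostComplexStructure

/-- Since `J² = -1`, a tangent vector `v` lies in `TM ∩ J TM` if and only if `J v` is tangent
to `M`. -/
theorem mem_almostContact_ξ {ι : M → W}
    (hι : Manifold.IsSmoothEmbedding (𝓡 (2 * n + 1)) (𝓡 (2 * n + 2)) ∞ ι) (x : M)
    (v : TangentSpace (𝓡 (2 * n + 1)) x) :
    v ∈ (J.almostContact hι).ξ x ↔ ∃ w, mfderiv (𝓡 (2 * n + 1)) (𝓡 (2 * n + 2)) ι x w =
      J.toFun (ι x) (mfderiv (𝓡 (2 * n + 1)) (𝓡 (2 * n + 2)) ι x v) := by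
  constructor
  · rintro ⟨-, z, ⟨w, hw⟩, hz⟩
    refine ⟨-w, ?_⟩
    have hz' : J.toFun (ι x) z = mfderiv (𝓡 (2 * n + 1)) (𝓡 (2 * n + 2)) ι x v := hz
    have hw' : mfderiv (𝓡 (2 * n + 1)) (𝓡 (2 * n + 2)) ι x w = z := hw
    rw [← hz', J.sq, map_neg, hw']
  · rintro ⟨w, hw⟩
    refine ⟨⟨v, rfl⟩, -mfderiv (𝓡 (2 * n + 1)) (𝓡 (2 * n + 2)) ι x w,
      Submodule.neg_mem _ ⟨w, rfl⟩, ?_⟩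
    rw [hw, map_neg, J.sq, neg_neg]
    rfl

/-- Reparametrizing a hypersurface transports its almost contact structure. -/
theorem map_almostContact {ι : M → W} {ι' : M' → W}
    (hι : Manifold.IsSmoothEmbedding (𝓡 (2 * n + 1)) (𝓡 (2 * n + 2)) ∞ ι)
    (hι' : Manifold.IsSmoothEmbedding (𝓡 (2 * n + 1)) (𝓡 (2 * n + 2)) ∞ ι')
    (φ : M ≃ₘ^∞⟮𝓡 (2 * n + 1), 𝓡 (2 * n + 1)⟯ M') (hφ : ∀ x, ι' (φ x) = ι x) :
    (J.almostContact hι).map φ = J.almostContact hι' := by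
  obtain rfl : ι' = ι ∘ φ.symm := funext fun y => by
    rw [Function.comp_apply, ← hφ, φ.apply_symm_apply]
  have hd : ∀ y, mfderiv (𝓡 (2 * n + 1)) (𝓡 (2 * n + 2)) (ι ∘ φ.symm) y =
      (mfderiv (𝓡 (2 * n + 1)) (𝓡 (2 * n + 2)) ι (φ.symm y)).comp
        (mfderiv (𝓡 (2 * n + 1)) (𝓡 (2 * n + 1)) φ.symm y) := fun y =>
    mfderiv_comp y ((hι.contMDiff _).mdifferentiableAt (by simp))
      (φ.symm.mdifferentiable (by simp) y)
  have hd' : ∀ y v, mfderiv (𝓡 (2 * n + 1)) (𝓡 (2 * n + 2)) (ι ∘ φ.symm) y v =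
      mfderiv (𝓡 (2 * n + 1)) (𝓡 (2 * n + 2)) ι (φ.symm y)
        (mfderiv (𝓡 (2 * n + 1)) (𝓡 (2 * n + 1)) φ.symm y v) := fun y v => by
    rw [hd]; rfl
  refine AlmostContactField.ext_of_forall_mem (fun y v => ?_) fun y v hv hv' => ?_
  · rw [AlmostContactField.mem_map_ξ, mem_almostContact_ξ, mem_almostContact_ξ]
    simp only [hd']
    exact ((φ.symm.mfderivToContinuousLinearEquiv (n := ∞) (by simp) y).surjective.exists
      (p := fun w => mfderiv (𝓡 (2 * n + 1)) (𝓡 (2 * n + 2)) ι (φ.symm y) w =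
        J.toFun (ι (φ.symm y)) (mfderiv (𝓡 (2 * n + 1)) (𝓡 (2 * n + 2)) ι (φ.symm y)
          (mfderiv (𝓡 (2 * n + 1)) (𝓡 (2 * n + 1)) φ.symm y v))))
  · refine injective_mfderiv_of_isSmoothEmbedding hι' y ?_
    rw [J.mfderiv_almostContact_J hι' y ⟨v, hv'⟩, hd' y v, hd',
      AlmostContactField.mfderiv_symm_map_J]
    exact J.mfderiv_almostContact_J hι _ _

/-- The almost contact structures of a smooth family of embedded hypersurfaces form a smooth
family: near a point, with `ν` and `π` the normal `1`-forms and tangential projections of the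
hypersurfaces `F t`, the hyperplanes are the kernels of `ν ∘ J ∘ dF` and the complex
multiplications are given by `π ∘ J ∘ dF`. -/
theorem isSmoothFamily_almostContact {F : ℝ → M → W}
    (hF : ContMDiffOn (𝓘(ℝ, ℝ).prod (𝓡 (2 * n + 1))) (𝓡 (2 * n + 2)) ∞
      (fun p : ℝ × M => F p.1 p.2) (Icc (0 : ℝ) 1 ×ˢ univ))
    (hemb : ∀ t ∈ Icc (0 : ℝ) 1,
      Manifold.IsSmoothEmbedding (𝓡 (2 * n + 1)) (𝓡 (2 * n + 2)) ∞ (F t))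
    {A : ℝ → AlmostContactField n M}
    (hA : ∀ t (ht : t ∈ Icc (0 : ℝ) 1), A t = J.almostContact (hemb t ht)) :
    AlmostContactField.IsSmoothFamily A := by
  refine AlmostContactField.isSmoothFamily_of_ker fun p₀ hp₀ => ?_
  obtain ⟨ν, π, h⟩ := exists_normal_form_and_projection (b := 2 * n + 2) rfl hF hp₀
    (injective_mfderiv_of_isSmoothEmbedding (hemb p₀.1 hp₀.1) p₀.2)
  refine ⟨fun p => ν p ∘ₗ J.toFun _ ∘ₗ
      (mfderiv (𝓡 (2 * n + 1)) (𝓡 (2 * n + 2)) (F p.1) p.2).toLinearMap,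
    fun p => π p ∘ₗ J.toFun _ ∘ₗ
      (mfderiv (𝓡 (2 * n + 1)) (𝓡 (2 * n + 2)) (F p.1) p.2).toLinearMap, ?_⟩
  filter_upwards [h, self_mem_nhdsWithin] with p ⟨hν, hπ, hsm⟩ hp
  rw [hA p.1 hp.1]
  refine ⟨fun v => ?_, fun v => ?_, fun Y hY => ?_⟩
  · exact (J.mem_almostContact_ξ (hemb p.1 hp.1) p.2 v).trans (hν _).symm
  · have h1 := hπ ((J.almostContact (hemb p.1 hp.1)).J p.2 v)
    rw [J.mfderiv_almostContact_J] at h1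
    exact h1.symm
  · exact hsm _ (J.smooth.contMDiffAt.comp_contMDiffWithinAt p (hF.mfderiv_family_apply hp hY))

theorem isSmooth_almostContact {ι : M → W}
    (hι : Manifold.IsSmoothEmbedding (𝓡 (2 * n + 1)) (𝓡 (2 * n + 2)) ∞ ι) :
    (J.almostContact hι).IsSmooth :=
  (J.isSmoothFamily_almostContact (F := fun _ => ι)
    (hι.contMDiff.comp contMDiff_snd).contMDiffOn (fun _ _ => hι)
    (A := fun _ => J.almostContact hι) fun _ _ => rfl).isSmooth (t := 0) (by simp)

end AlmostComplexStructure

/-- The homotopy is the push-forward of the structures that the hypersurfaces `F t` of the isotopy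
induce on `M`. -/
theorem IsIsotopy.homotopic_map_almostContact {ι : M → W} {ι' : M' → W} {F : ℝ → M → W}
    (hF : IsIsotopy (a := 2 * n + 1) (b := 2 * n + 2) ι ι' F)
    (hι : Manifold.IsSmoothEmbedding (𝓡 (2 * n + 1)) (𝓡 (2 * n + 2)) ∞ ι)
    (hι' : Manifold.IsSmoothEmbedding (𝓡 (2 * n + 1)) (𝓡 (2 * n + 2)) ∞ ι') :
    ((J.almostContact hι).map (hF.diffeo hι')).Homotopic (J.almostContact hι') := by
  classical
  obtain rfl := hF.start
  -- outside `[0, 1]` the family is arbitrary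
  let A : ℝ → AlmostContactField n M := fun t =>
    if ht : t ∈ Icc (0 : ℝ) 1 then J.almostContact (hF.isSmoothEmbedding t ht)
    else J.almostContact hι
  have hA : ∀ t (ht : t ∈ Icc (0 : ℝ) 1), A t = J.almostContact (hF.isSmoothEmbedding t ht) :=
    fun t ht => dif_pos ht
  refine ⟨_, (J.isSmoothFamily_almostContact hF.smooth hF.isSmoothEmbedding hA).map
    (hF.diffeo hι'), ?_, ?_⟩
  · simp only [hA 0 (by simp)]
  · simp only [hA 1 (by simp)]
    exact J.map_almostContact _ hι' _ fun x => diffeoOfRangeEq_apply _ _ _ x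

end

/-- Isotopic real hypersurfaces `M₁`, `M₂` of an almost complex manifold `(W, J)` are almost
contact homotopic, and every isotopy between them carries the formal homotopy class of `M₁` onto
that of `M₂`. -/
theorem mainTheorem4 (n : ℕ)
    {W : Type*} [TopologicalSpace W] [ChartedSpace (EuclideanSpace ℝ (Fin (2 * n + 2))) W]
    [IsManifold (𝓡 (2 * n + 2)) ∞ W] (J : AlmostComplexStructure (2 * n + 2) W)
    {M₁ : Type*} [TopologicalSpace M₁] [ChartedSpace (EuclideanSpace ℝ (Fin (2 * n + 1))) M₁]
    [IsManifold (𝓡 (2 * n + 1)) ∞ M₁]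
    {M₂ : Type*} [TopologicalSpace M₂] [ChartedSpace (EuclideanSpace ℝ (Fin (2 * n + 1))) M₂]
    [IsManifold (𝓡 (2 * n + 1)) ∞ M₂]
    (ι₁ : M₁ → W) (h₁ : Manifold.IsSmoothEmbedding (𝓡 (2 * n + 1)) (𝓡 (2 * n + 2)) ∞ ι₁)
    (ι₂ : M₂ → W) (h₂ : Manifold.IsSmoothEmbedding (𝓡 (2 * n + 1)) (𝓡 (2 * n + 2)) ∞ ι₂)
    (hiso : Isotopic (2 * n + 1) (2 * n + 2) ι₁ ι₂) :
    AlmostContactHomotopic ι₁ h₂ (J.almostContact h₁) (J.almostContact h₂) ∧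
    ∀ (F : ℝ → M₁ → W) (hF : IsIsotopy (a := 2 * n + 1) (b := 2 * n + 2) ι₁ ι₂ F),
      AlmostContactField.map (hF.diffeo h₂) '' (J.almostContact h₁).formalHomotopyClass =
        (J.almostContact h₂).formalHomotopyClass := by
  have hom := fun (F : ℝ → M₁ → W) (hF : IsIsotopy (a := 2 * n + 1) (b := 2 * n + 2) ι₁ ι₂ F) =>
    hF.homotopic_map_almostContact J h₁ h₂
  refine ⟨⟨J.isSmooth_almostContact h₁, J.isSmooth_almostContact h₂, hiso, hom⟩, fun F hF =>
    Subset.antisymm ?_ ?_⟩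
  · rintro _ ⟨T, ⟨hT, hST⟩, rfl⟩
    exact ⟨hT.map _, (hom F hF).symm.trans (hST.map _)⟩
  · rintro T ⟨hT, hST⟩
    refine ⟨T.map (hF.diffeo h₂).symm, ⟨hT.map _, ?_⟩, T.map_map_symm _⟩
    have h := ((hom F hF).trans hST).map (hF.diffeo h₂).symm
    rwa [AlmostContactField.map_symm_map] at h
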